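/- **Setting.** Let $U=\{u_1,\dots,u_n\}$ be a known, totally ordered universe and $S\subseteq U$ an unknown set with $w=|S|$. An *interval sample* on an interval $T=\{u_i,u_{i+1},\dots,u_j\}$, $i\le j$, returns a uniformly random element of $S\cap T$, independent of everything else, if $S\cap T\neq\emptyset$, and an indication that $S\cap T$ is empty otherwise. A (randomized) algorithm takes interval samples one after the other until it stops and outputs a real number $\widehat w$; let $N\in\{0,1,2,\dots\}\cup\{\infty\}$ be the number of samples that it takes. It is *non-adaptive* if, given its coin tosses, the interval sampled in each round does not depend on the answers received (the decision when to stop and the output may depend on them). For $\epsilon\in(0,1]$ it is a *set size approximation algorithm* with parameter $\epsilon$ if, for every $S\subseteq U$, with probability at least $2/3$ (over its coin tosses and the samples) it stops with an output such that $\frac{1}{1+\epsilon}|S|\le\widehat w\le(1+\epsilon)|S|$. **Theorem (Interval Subset Samples).** 1. There are absolute constants $c,p>0$ such that, for all integers $1\le w\le n$, all $\epsilon\in(0,1]$ and every non-adaptive set size approximation algorithm with parameter $\epsilon$ that performs only interval samples on a universe of size $n$, there is a set $S$ of size $w$ on which $$\Pr\bigl[N\ge c\,\min(n/w,\sqrt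 w)\bigr]\ge p .$$ 2. There is an absolute constant $C>0$ such that for all $n$ and all $\epsilon\in(0,1]$ there is a non-adaptive set size approximation algorithm with parameter $\epsilon$, using only interval samples, such that for every nonempty $S$, with $w=|S|$, and every real $k\ge1$ $$\Pr\Bigl[N>k\cdot C\,\frac{\min(n/w,\sqrt w)}{\epsilon^2}\Bigr]\le e^{-k}.$$ 3. There are an absolute constant $C>0$ and an integer $a\ge0$ such that for all $n$ and all $\epsilon\in(0,1]$ there is an (adaptive) set size approximation algorithm with parameter $\epsilon$, using only interval samples, such that for every nonempty $S$, with $w=|S|$, and every real $k\ge1$ $$\Pr\Bigl[N>k\cdot C\,\frac{(1+\log w)^4\,\bigl(1+\log(1+\log w)\bigr)^a}{\epsilon^2}\Bigr]\le e^{-k}.$$ -/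

import Mathlib

open MeasureTheory

noncomputable section

namespace IntervalSampling

/-- A nonempty interval `{u_i, …, u_j}` of the ordered universe `U = Fin n`, given by its
endpoints `i ≤ j`. -/
abbrev Interval (n : ℕ) : Type := {p : Fin n × Fin n // p.1 ≤ p.2}

/-- The set of elements of an interval. -/
def Interval.elems {n : ℕ} (T : Interval n) : Finset (Fin n) := Finset.Icc T.1.1 T.1.2

/-- The answer to a subset sample: `some u` is a sampled element, `none` indicates that the
intersection with the hidden set is empty. -/
def Answer (n : ℕ) : Type := Option (Fin n)

instance (n : ℕ) : MeasurableSpace (Answer n) := ⊤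

/-- The distribution of the answer to a subset sample on `T` when the hidden set is `S`:
uniform on `S ∩ T` if this set is nonempty, and the indication `none` otherwise. -/
def answerPMF {n : ℕ} (S : Finset (Fin n)) (T : Interval n) : PMF (Answer n) :=
  if h : (S ∩ T.elems).Nonempty then
    (PMF.uniformOfFinset (S ∩ T.elems) h).map (fun u => (some u : Option (Fin n)))
  else PMF.pure (none : Option (Fin n))

/-- A randomized algorithm that takes interval samples from a hidden subset of `Fin n`.
Its internal coin tosses are a point `ω` of a probability space. Given `ω` and the list of the
answers received so far (oldest first), it either takes a sample on an interval (`Sum.inl T`)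
or stops and outputs an estimate (`Sum.inr v`). -/
structure SampleAlgorithm (n : ℕ) where
  /-- the coin tosses -/
  Coins : Type
  [coinsMeasurableSpace : MeasurableSpace Coins]
  /-- the distribution of the coin tosses -/
  coinLaw : Measure Coins
  [isProbabilityMeasure_coinLaw : IsProbabilityMeasure coinLaw]
  /-- the next action -/
  step : Coins → List (Answer n) → Interval n ⊕ ℝ
  measurable_step : ∀ h, Measurable fun ω => step ω h

attribute [instance] SampleAlgorithm.coinsMeasurableSpace
  SampleAlgorithm.isProbabilityMeasure_coinLaw

namespace SampleAlgorithm

variable {n : ℕ} (A : SampleAlgorithm n)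

/-- The algorithm is non-adaptive: for given coin tosses, the interval sampled in each round
depends only on the number of the round and not on the answers. The decision when to stop, and
the output, may depend on the answers. -/
def NonAdaptive : Prop :=
  ∀ (ω : A.Coins) (h h' : List (Answer n)) (T T' : Interval n),
    h.length = h'.length → A.step ω h = Sum.inl T → A.step ω h' = Sum.inl T' → T = T'

/-- The sample space of an execution: the coin tosses, and for every round `t` and every
interval `T` the answer that is given if `T` is sampled in round `t`. -/
abbrev Outcome : Type := A.Coins × (ℕ × Interval n → Answer n)

/-- The law of an execution when the hidden set is `S`: the coin tosses and all the answers are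
independent, and the answer to a sample on `T` has the law `answerPMF S T`. -/
def law (S : Finset (Fin n)) : Measure A.Outcome :=
  A.coinLaw.prod (Measure.infinitePi fun i : ℕ × Interval n => (answerPMF S i.2).toMeasure)

/-- The list of answers received in the rounds before round `t`; it does not change any more
once the algorithm has stopped. -/
def history (z : A.Outcome) : ℕ → List (Answer n)
  | 0 => []
  | t + 1 =>
    match A.step z.1 (history z t) with
    | Sum.inl T => history z t ++ [z.2 (t, T)]
    | Sum.inr _ => history z t

/-- The total number of samples taken; it is `⊤` if the algorithm never stops. -/
def sampleCount (z : A.Outcome) : ENNReal := ⨆ t : ℕ, ((A.history z t).length : ENNReal)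

/-- The algorithm stops and outputs the estimate `v`. -/
def Outputs (z : A.Outcome) (v : ℝ) : Prop := ∃ t : ℕ, A.step z.1 (A.history z t) = Sum.inr v

/-- `A` is a set size approximation algorithm with approximation parameter `ε`: for every hidden
set `S`, with probability at least `2/3` it stops and its output is within a factor `1 + ε`
of `|S|`. -/
def IsSetSizeApprox (ε : ℝ) : Prop :=
  ∀ S : Finset (Fin n),
    ENNReal.ofReal (2 / 3) ≤
      A.law S {z | ∃ v : ℝ, A.Outputs z v ∧
        1 / (1 + ε) * (S.card : ℝ) ≤ v ∧ v ≤ (1 + ε) * (S.card : ℝ)}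

end SampleAlgorithm

end IntervalSampling

end

/-!
Both upper bounds rest on one tool. An execution reads answers adaptively from a table of independent
answers (`readList`), so a nonnegative function of the answers received so far whose conditional
expectation never increases is a supermartingale (`lintegral_readList_le`). A potential that is at
least `1` on a bad event therefore bounds the probability of this event by its initial value
(`SampleAlgorithm.answerLaw_history_le`). The estimates are second moments, the tails of the number
of samples are exponential moments, and both are verified one round at a time.

*Adaptive upper bound* (`exists_adaptive_upper_bound`). A chain samples the whole universe, then the
elements before the answer, then the elements before the new answer, until nothing is left. From `r`
remaining elements it moves to a uniform number below `r`, so the number of its answers has mean the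
harmonic number `H r = 1 + ⋯ + 1 / r` and variance at most `H r`. The average over `O(H / ε ^ 2)`
chains, where `H` belongs to the hidden set, gives `H` up to `ε / 4`, and this determines the size
up to a factor `1 + ε`. A pilot phase of `25` chains finds the order of magnitude of `H`. The total
number of samples is of order `H ^ 2 / ε ^ 2`, so that the second power of the logarithm is enough.

*Non-adaptive upper bound* (`exists_nonAdaptive_upper_bound`). Samples on the whole universe
alternate with samples on single random elements. A sample of the first kind repeats an earlier
answer with conditional probability `D / w`, where `D` is the number of elements seen before; one of
the second kind hits the hidden set with probability `w / n`. Each kind gives an estimate once it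
has had `K = O(1 / ε ^ 2)` successes: the number of successes minus its compensator is a martingale
whose variance at that time is at most `K`. The first kind needs `O(√w K)` samples, since the
conditional probabilities grow linearly, and the second kind `O((n / w) K)`.

*Lower bound* (`exists_nonAdaptive_lower_bound`). The universe contains about `n / (5 w)` disjoint
blocks of `w` groups of `5` neighbours. A hidden set consists either of a whole random block, or of
one random element from each group of a random block. The planned intervals do not depend on the
answers, and each of them splits at most two blocks, so with few samples it is likely that none
of them splits the random block. Every sample then is empty or uniform on the hidden set, and the
two kinds of hidden sets give the same transcripts as long as no two answers come from the same
group, which is likely for less than a small multiple of `√w` samples (`sum_answerLaw_le`). An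
algorithm that stops that early cannot have outputs that are right for both sizes `w` and `5 w`. If
the bound to be shown is at most `1`, it suffices that a correct algorithm takes a sample at all.
-/

noncomputable section

namespace IntervalSampling

open ProbabilityTheory
open scoped ENNReal

/-! ### Reading independent answers adaptively -/

section ReadList

variable {ι α : Type*}

/-- The list of the first answers read from the table `y` of possible answers: in round `t` the
answer to the request `i` is `y (t, i)`, and `c` chooses the next request from the answers read so
far, or stops by returning `none`. -/
def readList (c : List α → Option ι) (y : ℕ × ι → α) : ℕ → List α
  | 0 => []
  | t + 1 =>
    match c (readList c y t) with
    | some i => readList c y t ++ [y (t, i)]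
    | none => readList c y t

lemma readList_succ (c : List α → Option ι) (y : ℕ × ι → α) (t : ℕ) :
    readList c y (t + 1) = (c (readList c y t)).elim (readList c y t)
      fun i => readList c y t ++ [y (t, i)] := by
  rw [readList]; cases c (readList c y t) <;> rfl

lemma readList_succ_of_some {c : List α → Option ι} {y : ℕ × ι → α} {t : ℕ} {i : ι}
    (h : c (readList c y t) = some i) :
    readList c y (t + 1) = readList c y t ++ [y (t, i)] := by
  rw [readList_succ, h]; rfl

lemma readList_succ_of_none {c : List α → Option ι} {y : ℕ × ι → α} {t : ℕ}
    (h : c (readList c y t) = none) : readList c y (t + 1) = readList c y t := by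
  rw [readList_succ, h]; rfl

lemma readList_eq_of_none {c : List α → Option ι} {y : ℕ × ι → α} {t s : ℕ}
    (h : c (readList c y t) = none) (hts : t ≤ s) : readList c y s = readList c y t := by
  induction s, hts using Nat.le_induction with
  | base => rfl
  | succ s _ ih => rw [readList_succ_of_none (by rw [ih]; exact h), ih]

lemma length_readList_le (c : List α → Option ι) (y : ℕ × ι → α) (t : ℕ) :
    (readList c y t).length ≤ t := by
  induction t with
  | zero => simp [readList]
  | succ t ih =>
    rw [readList_succ]
    cases c (readList c y t) with
    | none => simp only [Option.elim]; omega
    | some i => simp only [Option.elim, List.length_append, List.length_singleton]; omega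

/-- The reader has stopped as soon as it has read fewer answers than rounds have passed. -/
lemma length_readList_eq_or (c : List α → Option ι) (y : ℕ × ι → α) (t : ℕ) :
    (readList c y t).length = t ∨ c (readList c y t) = none := by
  induction t with
  | zero => simp [readList]
  | succ t ih =>
    rcases hc : c (readList c y t) with _ | i
    · right; rw [readList_succ_of_none hc, hc]
    · left
      rw [hc] at ih
      rw [readList_succ_of_some hc]
      simpa using ih

/-- Only the answers of earlier rounds are read. -/
lemma readList_congr (c : List α → Option ι) {y y' : ℕ × ι → α} (t : ℕ)
    (h : ∀ s < t, ∀ i, y (s, i) = y' (s, i)) : readList c y t = readList c y' t := by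
  induction t with
  | zero => rfl
  | succ t ih =>
    rw [readList_succ, readList_succ, ih fun s hs i => h s (by omega) i]
    congr 1
    funext i
    rw [h t (by omega) i]

variable [Fintype ι] [Finite α] [MeasurableSpace α] [MeasurableSingletonClass α]

lemma measurable_comp_readList {γ : Type*} [MeasurableSpace γ] (c : List α → Option ι) (t : ℕ)
    (g : List α → γ) : Measurable fun y : ℕ × ι → α => g (readList c y t) := by
  classical
  rcases isEmpty_or_nonempty α with hα | ⟨⟨a⟩⟩
  · rcases isEmpty_or_nonempty ι with hι | ⟨⟨i⟩⟩
    · have : Subsingleton (ℕ × ι → α) := ⟨fun y y' => funext fun p => hι.elim p.2⟩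
      exact measurable_of_countable _
    · have : IsEmpty (ℕ × ι → α) := ⟨fun y => hα.elim (y (0, i))⟩
      exact measurable_of_empty _
  · let S : Finset (ℕ × ι) := Finset.range t ×ˢ Finset.univ
    have : (fun y : ℕ × ι → α => g (readList c y t)) =
        (fun r : S → α => g (readList c (fun p => if h : p ∈ S then r ⟨p, h⟩ else a) t)) ∘
          S.restrict := by
      funext y
      simp only [Function.comp]
      congr 1
      refine readList_congr c t fun s hs i => ?_
      have : (s, i) ∈ S := by simp [S, hs]
      simp [this]
    rw [this]
    exact (measurable_of_countable _).comp (Finset.measurable_restrict S)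

end ReadList

section ReadList

variable {ι α : Type*} [Fintype ι] [Finite α] [MeasurableSpace α] [MeasurableSingletonClass α]
  (ν : ι → Measure α) [∀ i, IsProbabilityMeasure (ν i)]

/-- The law of the table of possible answers: independent, with law `ν i` for the request `i`. -/
abbrev tableLaw : Measure (ℕ × ι → α) := Measure.infinitePi fun p : ℕ × ι => ν p.2

omit [Fintype ι] [Finite α] [MeasurableSingletonClass α] in
lemma map_eval_tableLaw (p : ℕ × ι) : (tableLaw ν).map (fun y => y p) = ν p.2 :=
  Measure.infinitePi_map_eval (fun p : ℕ × ι => ν p.2) p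

/-- The answer to a request made in round `t` is independent of the answers read before. -/
lemma lintegral_mul_readList (c : List α → Option ι) (t : ℕ) (i : ι) (g : List α → ℝ≥0∞)
    (F : α → ℝ≥0∞) :
    ∫⁻ y, g (readList c y t) * F (y (t, i)) ∂tableLaw ν =
      (∫⁻ y, g (readList c y t) ∂tableLaw ν) * ∫⁻ a, F a ∂ν i := by
  classical
  have hF : Measurable F := measurable_of_countable F
  have h2 : ∫⁻ a, F a ∂ν i = ∫⁻ y, F (y (t, i)) ∂tableLaw ν := by
    rw [← map_eval_tableLaw ν (t, i), lintegral_map hF (measurable_pi_apply _)]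
  rw [h2]
  refine lintegral_mul_eq_lintegral_mul_lintegral_of_indepFun
    (measurable_comp_readList c t g) (hF.comp (measurable_pi_apply _)) ?_
  have hind : iIndepFun (fun (p : ℕ × ι) (y : ℕ × ι → α) => y p) (tableLaw ν) :=
    iIndepFun_infinitePi (P := fun p : ℕ × ι => ν p.2) (X := fun _ a => a) fun _ => measurable_id
  obtain ⟨a⟩ : Nonempty α := (ν i).nonempty_of_neZero
  let S : Finset (ℕ × ι) := Finset.range t ×ˢ Finset.univ
  have hdis : Disjoint S {(t, i)} := by simp [S]
  have h := hind.indepFun_finset S {(t, i)} hdis fun p => measurable_pi_apply p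
  have h' := h.comp
    (φ := fun r : S → α => g (readList c (fun p => if h : p ∈ S then r ⟨p, h⟩ else a) t))
    (ψ := fun r : ({(t, i)} : Finset (ℕ × ι)) → α => F (r ⟨(t, i), by simp⟩))
    (measurable_of_countable _) (measurable_of_countable _)
  convert h' using 1
  · funext y
    simp only [Function.comp]
    congr 1
    refine readList_congr c t fun s hs j => ?_
    have : (s, j) ∈ S := by simp [S, hs]
    simp [this]
  · rfl

/-- A function of the answers whose conditional expectation does not increase in any round is a
supermartingale along the answers that are read. -/
theorem lintegral_readList_le (c : List α → Option ι) (F : List α → ℝ≥0∞)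
    (hF : ∀ h i, c h = some i → ∫⁻ a, F (h ++ [a]) ∂ν i ≤ F h) (t : ℕ) :
    ∫⁻ y, F (readList c y t) ∂tableLaw ν ≤ F [] := by
  classical
  induction t with
  | zero => simp [readList]
  | succ t ih =>
    refine le_trans ?_ ih
    let e : List α → List α → ℝ≥0∞ := fun l h => if h = l then 1 else 0
    have key : ∀ G : (ℕ × ι → α) → List α → ℝ≥0∞, ∀ y,
        G y (readList c y t) = ∑' l, e l (readList c y t) * G y l := by
      intro G y
      rw [tsum_eq_single (readList c y t)]
      · simp [e]
      · intro l hl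
        simp [e, hl.symm]
    have hmeas : ∀ l, Measurable fun y : ℕ × ι → α => e l (readList c y t) :=
      fun l => measurable_comp_readList c t (e l)
    have hmeas2 : ∀ l, Measurable fun y : ℕ × ι → α =>
        (c l).elim (F l) fun i => F (l ++ [y (t, i)]) := by
      intro l
      cases c l with
      | none => exact measurable_const
      | some i =>
        exact (measurable_of_countable fun a => F (l ++ [a])).comp (measurable_pi_apply (t, i))
    have h1 : ∀ y, F (readList c y (t + 1)) =
        ∑' l, e l (readList c y t) * (c l).elim (F l) fun i => F (l ++ [y (t, i)]) := by
      intro y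
      rw [← key (fun y l => (c l).elim (F l) fun i => F (l ++ [y (t, i)])) y, readList_succ]
      cases c (readList c y t) <;> rfl
    simp_rw [h1]
    have hm1 : ∀ l, AEMeasurable (fun y : ℕ × ι → α => e l (readList c y t) *
        (c l).elim (F l) fun i => F (l ++ [y (t, i)])) (tableLaw ν) :=
      fun l => ((hmeas l).mul (hmeas2 l)).aemeasurable
    rw [lintegral_tsum hm1]
    have h2 : ∀ y : ℕ × ι → α, F (readList c y t) = ∑' l, e l (readList c y t) * F l :=
      fun y => key (fun _ l => F l) y
    simp_rw [h2]
    have hm2 : ∀ l, AEMeasurable (fun y : ℕ × ι → α => e l (readList c y t) * F l)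
        (tableLaw ν) := fun l => ((hmeas l).mul_const _).aemeasurable
    rw [lintegral_tsum hm2]
    refine ENNReal.tsum_le_tsum fun l => ?_
    rw [lintegral_mul_const _ (hmeas l)]
    rcases hc : c l with _ | i
    · simp only [Option.elim]
      rw [lintegral_mul_const _ (hmeas l)]
    · simp only [Option.elim]
      rw [lintegral_mul_readList ν c t i (e l) fun a => F (l ++ [a])]
      gcongr
      exact hF l i hc

/-- A bound on the probability of a bad event, from a potential `F` that is at least `1` on it and
does not increase in expectation; `Inv` is an invariant that holds almost surely. -/
theorem tableLaw_readList_le (c : List α → Option ι) (Inv : List α → Prop) (F : List α → ℝ≥0∞)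
    (hInv0 : Inv []) (hInv : ∀ h i, Inv h → c h = some i → ∀ᵐ a ∂ν i, Inv (h ++ [a]))
    (hF : ∀ h i, Inv h → c h = some i → ∫⁻ a, F (h ++ [a]) ∂ν i ≤ F h)
    (bad : List α → Prop) (hbad : ∀ h, Inv h → bad h → 1 ≤ F h) (t : ℕ) :
    tableLaw ν {y | bad (readList c y t)} ≤ F [] := by
  classical
  let F' : List α → ℝ≥0∞ := fun h => if Inv h then F h else ⊤
  have h1 : ∫⁻ y, F' (readList c y t) ∂tableLaw ν ≤ F' [] := by
    refine lintegral_readList_le ν c F' (fun h i hc => ?_) t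
    by_cases hi : Inv h
    · simp only [F', hi, if_true]
      refine le_trans (le_of_eq ?_) (hF h i hi hc)
      refine lintegral_congr_ae ?_
      filter_upwards [hInv h i hi hc] with a ha
      simp [ha]
    · simp [F', hi]
  have h2 : tableLaw ν {y | bad (readList c y t)} ≤
      tableLaw ν {y | 1 ≤ F' (readList c y t)} := by
    refine measure_mono fun y hy => ?_
    simp only [Set.mem_ofPred_eq] at hy ⊢
    by_cases hi : Inv (readList c y t)
    · simp only [F', hi, if_true]; exact hbad _ hi hy
    · simp [F', hi]
  have h3 := mul_meas_ge_le_lintegral (μ := tableLaw ν) (measurable_comp_readList c t F') 1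
  rw [one_mul] at h3
  simpa [F', hInv0] using h2.trans (h3.trans h1)

end ReadList

/-! ### Answers to interval samples -/

/-- The answer that shows the element `u`. -/
def hit {n : ℕ} (u : Fin n) : Answer n := (some u : Option (Fin n))

/-- The answer that indicates an empty intersection. -/
def miss {n : ℕ} : Answer n := (none : Option (Fin n))

instance (n : ℕ) : Finite (Answer n) := inferInstanceAs (Finite (Option (Fin n)))

instance (n : ℕ) : DecidableEq (Answer n) := inferInstanceAs (DecidableEq (Option (Fin n)))

instance (n : ℕ) : MeasurableSingletonClass (Answer n) := ⟨fun _ => trivial⟩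

lemma hit_injective {n : ℕ} : Function.Injective (hit : Fin n → Answer n) :=
  fun _ _ h => Option.some.inj h

lemma hit_ne_miss {n : ℕ} (u : Fin n) : hit u ≠ miss := fun h => Option.some_ne_none u h

lemma eq_miss_or_eq_hit {n : ℕ} : ∀ a : Answer n, a = miss ∨ ∃ u, a = hit u
  | none => Or.inl rfl
  | some u => Or.inr ⟨u, rfl⟩

section Answers

variable {n : ℕ} {S : Finset (Fin n)} {T : Interval n}

lemma answerPMF_eq : answerPMF S T =
    if h : (S ∩ T.elems).Nonempty then (PMF.uniformOfFinset (S ∩ T.elems) h).map hit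
    else PMF.pure miss := rfl

lemma toMeasure_answerPMF_of_eq_empty (h : S ∩ T.elems = ∅) :
    (answerPMF S T).toMeasure = Measure.dirac miss := by
  have h' : ¬ (S ∩ T.elems).Nonempty := by simp [h]
  rw [answerPMF_eq, dif_neg h', PMF.toMeasure_pure]

/-- The law of the answer is the image of the uniform distribution on `β` if the elements of
`S ∩ T` are listed without repetition by `β`. -/
lemma toMeasure_answerPMF_eq_map {β : Type*} [Fintype β] [Nonempty β] [MeasurableSpace β]
    [MeasurableSingletonClass β] {e : β → Fin n} (he : Function.Injective e)
    (hST : S ∩ T.elems = Finset.univ.map ⟨e, he⟩) :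
    (answerPMF S T).toMeasure = (uniformOn Set.univ : Measure β).map fun b => hit (e b) := by
  have h' : (S ∩ T.elems).Nonempty := by simp [hST]
  refine Measure.ext_of_singleton fun a => ?_
  rw [answerPMF_eq, dif_pos h', PMF.toMeasure_apply_singleton _ _ (measurableSet_singleton _),
    Measure.map_apply (measurable_of_countable _) (measurableSet_singleton _), uniformOn_univ,
    PMF.map_apply]
  rcases eq_miss_or_eq_hit a with rfl | ⟨u, rfl⟩
  · rw [ENNReal.tsum_eq_zero.2]
    · symm
      rw [ENNReal.div_eq_zero_iff]; left
      convert measure_empty (μ := Measure.count)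
      ext b
      simp [hit_ne_miss]
    · intro u; simp [(hit_ne_miss u).symm]
  · rw [tsum_eq_single u]
    · have hp : (fun b => hit (e b)) ⁻¹' {hit u} = {b | e b = u} := by
        ext b; exact ⟨fun h => hit_injective h, fun h => congrArg hit h⟩
      rw [hp]
      simp only [if_true, PMF.uniformOfFinset_apply]
      by_cases hu : ∃ b, e b = u
      · obtain ⟨b, rfl⟩ := hu
        have hb : {b' | e b' = e b} = {b} := by ext b'; simp [he.eq_iff]
        rw [hb, Measure.count_singleton, if_pos (by simp [hST]), hST]
        simp
      · have hb : {b' | e b' = u} = ∅ := by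
          ext b'; simp only [Set.mem_ofPred_eq, Set.mem_empty_iff_false, iff_false]
          exact fun h => hu ⟨b', h⟩
        rw [hb, measure_empty (μ := Measure.count), if_neg (by simpa [hST] using hu)]
        simp
    · intro v hv
      rw [if_neg]
      intro h
      exact hv (hit_injective h).symm

lemma lintegral_answerPMF (h : (S ∩ T.elems).Nonempty) (F : Answer n → ℝ≥0∞) :
    ∫⁻ a, F a ∂(answerPMF S T).toMeasure =
      (∑ u ∈ S ∩ T.elems, F (hit u)) / (S ∩ T.elems).card := by
  have : Nonempty ↥(S ∩ T.elems) := h.to_subtype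
  have he : Function.Injective (fun u : ↥(S ∩ T.elems) => (u : Fin n)) := Subtype.val_injective
  rw [toMeasure_answerPMF_eq_map he (by ext u; simp),
    lintegral_map (measurable_of_countable _) (measurable_of_countable _), lintegral_fintype]
  have h1 : ∀ x : ↥(S ∩ T.elems), (uniformOn Set.univ : Measure ↥(S ∩ T.elems)) {x} =
      ((S ∩ T.elems).card : ℝ≥0∞)⁻¹ := by
    intro x
    rw [uniformOn_univ, Measure.count_singleton, one_div, Fintype.card_coe]
  simp_rw [h1]
  rw [← Finset.sum_mul, div_eq_mul_inv, ← Finset.sum_coe_sort (S ∩ T.elems)]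

lemma ae_answerPMF (h : (S ∩ T.elems).Nonempty) {p : Answer n → Prop}
    (hp : ∀ u ∈ S ∩ T.elems, p (hit u)) : ∀ᵐ a ∂(answerPMF S T).toMeasure, p a := by
  classical
  have h1 := lintegral_answerPMF h fun a => if p a then 0 else 1
  rw [Finset.sum_eq_zero (fun u hu => by simp [hp u hu]), ENNReal.zero_div,
    lintegral_eq_zero_iff (measurable_of_countable _)] at h1
  filter_upwards [h1] with a ha
  by_contra hpa
  simp [hpa] at ha

end Answers

/-! ### Executions -/

namespace SampleAlgorithm

variable {n : ℕ} (A : SampleAlgorithm n)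

/-- The interval requested after the answers `h`, or `none` if the algorithm stops. -/
def request (ω : A.Coins) (h : List (Answer n)) : Option (Interval n) := (A.step ω h).getLeft?

/-- The law of the answers that the algorithm may receive. -/
abbrev answerLaw (S : Finset (Fin n)) : Measure (ℕ × Interval n → Answer n) :=
  tableLaw fun T => (answerPMF S T).toMeasure

lemma law_eq (S : Finset (Fin n)) : A.law S = A.coinLaw.prod (answerLaw S) := rfl

instance (S : Finset (Fin n)) : IsProbabilityMeasure (A.law S) := by
  rw [law_eq]; infer_instance

variable {A}

lemma request_eq_some {ω : A.Coins} {h : List (Answer n)} {T : Interval n} :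
    A.request ω h = some T ↔ A.step ω h = Sum.inl T := by
  rw [request]; cases A.step ω h <;> simp

lemma request_eq_none {ω : A.Coins} {h : List (Answer n)} :
    A.request ω h = none ↔ ∃ v, A.step ω h = Sum.inr v := by
  rw [request]; cases A.step ω h <;> simp

lemma history_eq_readList (z : A.Outcome) (t : ℕ) :
    A.history z t = readList (A.request z.1) z.2 t := by
  induction t with
  | zero => rfl
  | succ t ih =>
    rw [history, readList_succ, ← ih, request]
    rcases A.step z.1 (A.history z t) with T | v <;> rfl

lemma length_history_le (z : A.Outcome) (t : ℕ) : (A.history z t).length ≤ t := by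
  rw [history_eq_readList]; exact length_readList_le _ _ _

lemma length_history_eq_or (z : A.Outcome) (t : ℕ) :
    (A.history z t).length = t ∨ ∃ v, A.step z.1 (A.history z t) = Sum.inr v := by
  rw [history_eq_readList, ← request_eq_none]; exact length_readList_eq_or _ _ _

lemma history_eq_of_step {z : A.Outcome} {t s : ℕ} {v : ℝ}
    (h : A.step z.1 (A.history z t) = Sum.inr v) (hts : t ≤ s) :
    A.history z s = A.history z t := by
  rw [history_eq_readList, history_eq_readList]
  refine readList_eq_of_none (request_eq_none.2 ⟨v, ?_⟩) hts
  rwa [← history_eq_readList]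

lemma Outputs.unique {z : A.Outcome} {v v' : ℝ} (h : A.Outputs z v) (h' : A.Outputs z v') :
    v = v' := by
  obtain ⟨t, ht⟩ := h
  obtain ⟨s, hs⟩ := h'
  rcases le_total t s with hts | hts
  · rw [history_eq_of_step ht hts, ht] at hs; exact Sum.inr.inj hs
  · rw [history_eq_of_step hs hts, hs] at ht; exact (Sum.inr.inj ht).symm

lemma length_history_of_le_sampleCount {z : A.Outcome} {m : ℕ}
    (h : (m : ℝ≥0∞) ≤ A.sampleCount z) : (A.history z m).length = m := by
  rcases length_history_eq_or z m with h1 | ⟨v, hv⟩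
  · exact h1
  · by_contra hne
    have hlt : (A.history z m).length < m := lt_of_le_of_ne (length_history_le z m) hne
    have : A.sampleCount z ≤ ((A.history z m).length : ℝ≥0∞) := by
      refine iSup_le fun t => ?_
      rcases le_total t m with ht | ht
      · rcases length_history_eq_or z t with h2 | ⟨v', hv'⟩
        · by_cases htm : t = m
          · rw [htm]
          · by_contra hcon
            simp only [Nat.cast_le, not_le] at hcon
            have hmono : (A.history z t).length ≤ (A.history z m).length := by
              clear * - ht
              induction m, ht using Nat.le_induction with
              | base => rfl
              | succ s _ ih =>
                refine ih.trans ?_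
                rw [history_eq_readList, history_eq_readList, readList_succ]
                cases A.request z.1 (readList (A.request z.1) z.2 s) <;> simp
            omega
        · rw [history_eq_of_step hv' ht]
      · rw [history_eq_of_step hv ht]
    have h3 : (m : ℝ≥0∞) ≤ ((A.history z m).length : ℝ≥0∞) := h.trans this
    rw [Nat.cast_le] at h3
    omega

lemma le_sampleCount_of_length_history {z : A.Outcome} {m : ℕ}
    (h : (A.history z m).length = m) : (m : ℝ≥0∞) ≤ A.sampleCount z := by
  have := le_iSup (fun t : ℕ => ((A.history z t).length : ℝ≥0∞)) m
  rwa [h] at this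

/-- The next request, as a function of the coin tosses, is measurable. -/
lemma measurable_request (h : List (Answer n)) :
    @Measurable _ _ _ ⊤ fun ω : A.Coins => A.request ω h := by
  have : @Measurable _ _ _ ⊤ (Sum.getLeft? : Interval n ⊕ ℝ → Option (Interval n)) := by
    let _ : MeasurableSpace (Option (Interval n)) := ⊤
    exact measurable_fun_sum (measurable_of_countable _) measurable_const
  exact this.comp (A.measurable_step h)

lemma measurable_history (t : ℕ) : @Measurable _ _ _ ⊤ fun z : A.Outcome => A.history z t := by
  let _ : MeasurableSpace (List (Answer n)) := ⊤
  let _ : MeasurableSpace (Option (Interval n)) := ⊤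
  induction t with
  | zero => exact measurable_const
  | succ t ih =>
    let f : List (Answer n) × A.Outcome → List (Answer n) := fun p =>
      (A.request p.2.1 p.1).elim p.1 fun T => p.1 ++ [p.2.2 (t, T)]
    have hf : Measurable f := by
      refine measurable_from_prod_countable_right fun h => ?_
      let g : Option (Interval n) × A.Outcome → List (Answer n) := fun p =>
        p.1.elim h fun T => h ++ [p.2.2 (t, T)]
      have hg : Measurable g := by
        refine measurable_from_prod_countable_right fun o => ?_
        cases o with
        | none => exact measurable_const
        | some T =>
          exact (measurable_of_countable fun a : Answer n => h ++ [a]).comp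
            ((measurable_pi_apply (t, T)).comp measurable_snd)
      exact hg.comp (((measurable_request h).comp measurable_fst).prodMk measurable_id)
    have : (fun z : A.Outcome => A.history z (t + 1)) = fun z => f (A.history z t, z) := by
      funext z
      simp only [history_eq_readList, readList_succ, f]
    rw [this]
    exact hf.comp (ih.prodMk measurable_id)

lemma measurable_step_history (t : ℕ) :
    Measurable fun z : A.Outcome => A.step z.1 (A.history z t) := by
  let _ : MeasurableSpace (List (Answer n)) := ⊤
  have hf : Measurable fun p : List (Answer n) × A.Outcome => A.step p.2.1 p.1 :=
    measurable_from_prod_countable_right fun h => (A.measurable_step h).comp measurable_fst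
  exact hf.comp ((measurable_history t).prodMk measurable_id)

/-- The potential argument for given coin tosses: `f` is nonnegative, at least `1` on the bad
histories, and does not increase in expectation. -/
theorem answerLaw_history_le {S : Finset (Fin n)} {ω : A.Coins} (Inv : List (Answer n) → Prop)
    (f : List (Answer n) → ℝ) (hInv0 : Inv []) (hf0 : ∀ h, Inv h → 0 ≤ f h)
    (hmiss : ∀ h T, Inv h → A.step ω h = Sum.inl T → S ∩ T.elems = ∅ →
      Inv (h ++ [miss]) ∧ f (h ++ [miss]) ≤ f h)
    (hhit : ∀ h T, Inv h → A.step ω h = Sum.inl T → (S ∩ T.elems).Nonempty →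
      (∀ u ∈ S ∩ T.elems, Inv (h ++ [hit u])) ∧
      ∑ u ∈ S ∩ T.elems, f (h ++ [hit u]) ≤ (S ∩ T.elems).card * f h)
    (bad : List (Answer n) → Prop) (hbad : ∀ h, Inv h → bad h → 1 ≤ f h) (t : ℕ) :
    answerLaw S {y | bad (A.history (ω, y) t)} ≤ ENNReal.ofReal (f []) := by
  simp_rw [history_eq_readList]
  refine tableLaw_readList_le _ _ Inv (fun h => ENNReal.ofReal (f h)) hInv0 ?_ ?_ bad ?_ t
  · intro h T hi hT
    rw [request_eq_some] at hT
    rcases Finset.eq_empty_or_nonempty (S ∩ T.elems) with he | hne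
    · rw [toMeasure_answerPMF_of_eq_empty he, ae_dirac_eq]
      exact (hmiss h T hi hT he).1
    · exact ae_answerPMF hne (hhit h T hi hT hne).1
  · intro h T hi hT
    rw [request_eq_some] at hT
    rcases Finset.eq_empty_or_nonempty (S ∩ T.elems) with he | hne
    · rw [toMeasure_answerPMF_of_eq_empty he, lintegral_dirac]
      exact ENNReal.ofReal_le_ofReal (hmiss h T hi hT he).2
    · obtain ⟨h1, h2⟩ := hhit h T hi hT hne
      rw [lintegral_answerPMF hne, ← ENNReal.ofReal_sum_of_nonneg fun u hu => hf0 _ (h1 u hu)]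
      refine ENNReal.div_le_of_le_mul ?_
      rw [← ENNReal.ofReal_natCast, ← ENNReal.ofReal_mul (hf0 h hi), mul_comm]
      exact ENNReal.ofReal_le_ofReal h2
  · intro h hi hb
    exact ENNReal.one_le_ofReal.2 (hbad h hi hb)

lemma measurableSet_history (bad : List (Answer n) → Prop) (t : ℕ) :
    MeasurableSet {z : A.Outcome | bad (A.history z t)} := by
  let _ : MeasurableSpace (List (Answer n)) := ⊤
  exact measurable_history t (show MeasurableSet {h | bad h} from trivial)

/-- A bad event has at most the probability that it has for the worst coin tosses outside of an
exceptional set, plus the probability of the exceptional set. -/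
lemma law_history_le {S : Finset (Fin n)} (bad : List (Answer n) → Prop) (t : ℕ)
    (B : Set A.Coins) (c : ℝ≥0∞)
    (h : ∀ ω ∉ B, answerLaw S {y | bad (A.history (ω, y) t)} ≤ c) :
    A.law S {z | bad (A.history z t)} ≤ c + A.coinLaw B := by
  classical
  rw [law_eq, Measure.prod_apply (measurableSet_history bad t)]
  calc _ ≤ ∫⁻ ω, (c + B.indicator (fun _ => 1) ω) ∂A.coinLaw := by
        refine lintegral_mono fun ω => ?_
        by_cases hω : ω ∈ B
        · simp only [hω, Set.indicator_of_mem]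
          exact le_add_left prob_le_one
        · simpa [hω] using h ω hω
    _ = c + ∫⁻ ω, B.indicator (fun _ => 1) ω ∂A.coinLaw := by
        rw [lintegral_add_left measurable_const]; simp
    _ ≤ _ := by
        gcongr
        simpa using lintegral_indicator_const_le (μ := A.coinLaw) B 1

/-- The success probability of an algorithm that is unlikely to run for `m` rounds and unlikely
to have stopped with a bad output by then. -/
lemma le_law_outputs {S : Finset (Fin n)} (good : ℝ → Prop) (m : ℕ) (a b : ℝ) (ha : 0 ≤ a)
    (hb : 0 ≤ b) (hab : a + b ≤ 1 / 3)
    (hlen : A.law S {z | (A.history z m).length = m} ≤ ENNReal.ofReal a)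
    (hbad : A.law S {z | ∃ v, A.step z.1 (A.history z m) = Sum.inr v ∧ ¬ good v} ≤
      ENNReal.ofReal b) :
    ENNReal.ofReal (2 / 3) ≤ A.law S {z | ∃ v, A.Outputs z v ∧ good v} := by
  have hcover : (Set.univ : Set A.Outcome) ⊆ {z | ∃ v, A.Outputs z v ∧ good v} ∪
      ({z | (A.history z m).length = m} ∪
        {z | ∃ v, A.step z.1 (A.history z m) = Sum.inr v ∧ ¬ good v}) := by
    intro z _
    rcases length_history_eq_or z m with h | ⟨v, hv⟩
    · exact Or.inr (Or.inl h)
    · by_cases hg : good v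
      · exact Or.inl ⟨v, ⟨m, hv⟩, hg⟩
      · exact Or.inr (Or.inr ⟨v, hv, hg⟩)
  have h1 : (1 : ℝ≥0∞) ≤ A.law S {z | ∃ v, A.Outputs z v ∧ good v} + ENNReal.ofReal (1 / 3) := by
    calc (1 : ℝ≥0∞) = A.law S Set.univ := measure_univ.symm
      _ ≤ _ := measure_mono hcover
      _ ≤ A.law S {z | ∃ v, A.Outputs z v ∧ good v} +
          (ENNReal.ofReal a + ENNReal.ofReal b) :=
        (measure_union_le _ _).trans (by gcongr; exact (measure_union_le _ _).trans (by gcongr))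
      _ ≤ _ := by
        rw [← ENNReal.ofReal_add ha hb]
        gcongr
  have h2 : (1 : ℝ≥0∞) = ENNReal.ofReal (2 / 3) + ENNReal.ofReal (1 / 3) := by
    rw [← ENNReal.ofReal_add (by norm_num) (by norm_num)]; norm_num
  rw [h2] at h1
  exact (ENNReal.add_le_add_iff_right ENNReal.ofReal_ne_top).1 h1

lemma law_lt_sampleCount_le {S : Finset (Fin n)} {x : ℝ} {m : ℕ} (hm : (m : ℝ) ≤ x) :
    A.law S {z | ENNReal.ofReal x < A.sampleCount z} ≤
      A.law S {z | (A.history z m).length = m} := by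
  refine measure_mono fun z hz => length_history_of_le_sampleCount ?_
  refine le_trans ?_ (le_of_lt hz)
  rw [← ENNReal.ofReal_natCast]
  exact ENNReal.ofReal_le_ofReal hm

end SampleAlgorithm

/-! ### Harmonic numbers -/

/-- The harmonic number `1 + 1/2 + ⋯ + 1/r` as a real number. -/
abbrev harm (r : ℕ) : ℝ := (harmonic r : ℚ)

lemma harm_zero : harm 0 = 0 := by simp [harm]

lemma harm_succ (r : ℕ) : harm (r + 1) = harm r + 1 / ((r : ℝ) + 1) := by
  simp [harm, harmonic_succ]

lemma harm_nonneg (r : ℕ) : 0 ≤ harm r := by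
  induction r with
  | zero => simp [harm]
  | succ r ih => rw [harm_succ]; positivity

lemma one_le_harm {r : ℕ} (hr : 1 ≤ r) : 1 ≤ harm r := by
  induction r, hr using Nat.le_induction with
  | base => norm_num [harm]
  | succ r _ ih => rw [harm_succ]; have : 0 ≤ 1 / ((r : ℝ) + 1) := by positivity
                   linarith

lemma sum_harm (r : ℕ) : ∑ j ∈ Finset.range r, harm j = r * (harm r - 1) := by
  induction r with
  | zero => simp
  | succ r ih =>
    rw [Finset.sum_range_succ, ih, harm_succ]
    push_cast
    field_simp
    ring

lemma sum_sq_harm_sub (r : ℕ) : ∑ j ∈ Finset.range r, (harm r - harm j) ^ 2 ≤ 2 * r := by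
  induction r with
  | zero => simp
  | succ r ih =>
    have h1 : ∀ j, (harm (r + 1) - harm j) ^ 2 = (harm r - harm j) ^ 2 +
        (2 / ((r : ℝ) + 1) * harm r + (1 / ((r : ℝ) + 1)) ^ 2 - 2 / ((r : ℝ) + 1) * harm j) := by
      intro j; rw [harm_succ]; ring
    rw [Finset.sum_range_succ, Finset.sum_congr rfl fun j _ => h1 j, Finset.sum_add_distrib,
      Finset.sum_sub_distrib, ← Finset.mul_sum, sum_harm, h1 r]
    simp only [Finset.sum_const, Finset.card_range, nsmul_eq_mul]
    push_cast
    have h2 : (r : ℝ) * (2 / ((r : ℝ) + 1) * harm r + (1 / ((r : ℝ) + 1)) ^ 2) -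
        2 / ((r : ℝ) + 1) * (r * (harm r - 1)) + ((harm r - harm r) ^ 2 +
        (2 / ((r : ℝ) + 1) * harm r + (1 / ((r : ℝ) + 1)) ^ 2 - 2 / ((r : ℝ) + 1) * harm r)) =
        2 - 1 / ((r : ℝ) + 1) := by
      field_simp; ring
    have h3 : 0 ≤ 1 / ((r : ℝ) + 1) := by positivity
    linarith

/-- Each of the reciprocals of the numbers from `a + 1` to `b` is at least `1 / b`. -/
lemma le_harm_sub {a b : ℕ} (hab : a ≤ b) :
    ((b : ℝ) - a) / b ≤ harm b - harm a := by
  have : ∀ c, a ≤ c → c ≤ b → ((c : ℝ) - a) / b ≤ harm c - harm a := by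
    intro c hc
    induction c, hc using Nat.le_induction with
    | base => simp
    | succ c _ ih =>
      intro hcb
      have h1 := ih (by omega)
      have h2 : (1 : ℝ) / b ≤ 1 / ((c : ℝ) + 1) :=
        one_div_le_one_div_of_le (by positivity) (by exact_mod_cast hcb)
      rw [harm_succ]
      have h3 : (((c + 1 : ℕ) : ℝ) - a) / b = ((c : ℝ) - a) / b + 1 / b := by push_cast; ring
      linarith
  exact this b hab le_rfl

/-- Close harmonic numbers have close indices. -/
lemma le_of_harm_le {a b : ℕ} {ε : ℝ} (h0 : 0 < ε) (h1 : ε ≤ 1)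
    (h : harm b - harm a ≤ ε / 2) : (b : ℝ) ≤ (1 + ε) * a := by
  by_contra hcon
  push Not at hcon
  have hab : (a : ℝ) < b := by nlinarith [Nat.cast_nonneg (α := ℝ) a]
  have hb : 0 < (b : ℝ) := lt_of_le_of_lt (Nat.cast_nonneg a) hab
  have h2 := (le_harm_sub (by exact_mod_cast hab.le)).trans h
  rw [div_le_iff₀ hb] at h2
  nlinarith [Nat.cast_nonneg (α := ℝ) a]

/-! ### Ranks -/

lemma sum_rank {m : ℕ} (A : Finset (Fin m)) (g : ℕ → ℝ) :
    ∑ u ∈ A, g (A.filter (· < u)).card = ∑ j ∈ Finset.range A.card, g j := by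
  induction A using Finset.induction_on_max with
  | empty => simp
  | insert a A hA ih =>
    have ha : a ∉ A := fun h => lt_irrefl _ (hA a h)
    rw [Finset.sum_insert ha, Finset.card_insert_of_notMem ha, Finset.sum_range_succ, ← ih,
      add_comm]
    congr 1
    · refine Finset.sum_congr rfl fun u hu => ?_
      rw [Finset.filter_insert, if_neg (not_lt.2 (hA u hu).le)]
    · rw [Finset.filter_insert, if_neg (lt_irrefl a), Finset.filter_true_of_mem hA]

/-! ### Counting records: the adaptive algorithm -/

namespace Records

/-- The state of the adaptive algorithm on the universe `Fin (m + 1)`. It runs chains: a chain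
samples initial segments of the universe, each ending just before the previous answer, until
nothing is left. The algorithm counts the answered samples, first in a pilot phase with a fixed
number of chains, then in the main phase. -/
structure State (m : ℕ) where
  /-- the number of chains in the main phase, and `0` during the pilot phase -/
  goal : ℕ
  /-- the number of chains of the phase that are not finished -/
  left : ℕ
  /-- the number of answered samples in the phase -/
  count : ℕ
  /-- the next sample is taken on `{0, …, last}` -/
  last : Fin (m + 1)

variable {m : ℕ}

/-- The state after a chain has ended; `R` gives the number of chains in the main phase in terms
of the count of the pilot phase. -/
def endChain (R : ℕ → ℕ) (s : State m) : State m :=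
  if s.goal = 0 ∧ s.left = 1 then ⟨R s.count, R s.count, 0, Fin.last m⟩
  else ⟨s.goal, s.left - 1, s.count, Fin.last m⟩

/-- The state after an answer. -/
def next (R : ℕ → ℕ) (s : State m) : Answer (m + 1) → State m
  | none => endChain R s
  | some u =>
    if u = 0 then endChain R ⟨s.goal, s.left, s.count + 1, s.last⟩
    else ⟨s.goal, s.left, s.count + 1, ⟨u - 1, by omega⟩⟩

/-- The initial state: `25` pilot chains, which is enough for the pilot count to be at least half of
its mean with probability `21 / 25`. -/
def init : State m := ⟨0, 25, 0, Fin.last m⟩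

/-- The state after a list of answers. -/
def state (R : ℕ → ℕ) (h : List (Answer (m + 1))) : State m := h.foldl (next R) init

lemma state_append (R : ℕ → ℕ) (h : List (Answer (m + 1))) (a : Answer (m + 1)) :
    state R (h ++ [a]) = next R (state R h) a := by simp [state]

/-- A natural number whose harmonic number is `ε / 4`-close to `x`, if there is one. -/
def estimate (ε x : ℝ) : ℝ :=
  open Classical in if h : ∃ k : ℕ, |harm k - x| ≤ ε / 4 then (h.choose : ℝ) else 0

/-- The interval `{0, …, u}`. -/
def initial (u : Fin (m + 1)) : Interval (m + 1) := ⟨(0, u), Fin.zero_le u⟩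

/-- The next action in a state. -/
def action (ε : ℝ) (s : State m) : Interval (m + 1) ⊕ ℝ :=
  if s.left = 0 then Sum.inr (estimate ε (s.count / s.goal)) else Sum.inl (initial s.last)

/-- The number of chains in the main phase, in terms of the count of the pilot phase. If this count
is at least half of its mean, then the variance of the average over this many chains is at most
`2 / 25` times `(ε / 4) ^ 2`. -/
def mainChains (ε : ℝ) (t : ℕ) : ℕ := ⌈16 * ((t : ℝ) + 1) / ε ^ 2⌉₊

/-- The adaptive algorithm. It estimates the harmonic number of the size of the hidden set, which
is the expected count of a chain. -/
def algorithm (m : ℕ) (ε : ℝ) : SampleAlgorithm (m + 1) where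
  Coins := Unit
  coinLaw := Measure.dirac ()
  step _ h := action ε (state (mainChains ε) h)
  measurable_step _ := measurable_const

lemma mem_elems_initial {u v : Fin (m + 1)} : v ∈ (initial u).elems ↔ v ≤ u := by
  simp [initial, Interval.elems]

lemma inter_initial (S : Finset (Fin (m + 1))) (u : Fin (m + 1)) :
    S ∩ (initial u).elems = S.filter (· ≤ u) := by
  ext v; simp [mem_elems_initial]

lemma inter_initial_last (S : Finset (Fin (m + 1))) :
    S ∩ (initial (Fin.last m)).elems = S := by
  ext v; simp [mem_elems_initial, Fin.le_last]

lemma next_miss (R : ℕ → ℕ) (s : State m) : next R s miss = endChain R s := rfl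

lemma next_hit (R : ℕ → ℕ) (s : State m) (u : Fin (m + 1)) : next R s (hit u) =
    if u = 0 then endChain R ⟨s.goal, s.left, s.count + 1, s.last⟩
    else ⟨s.goal, s.left, s.count + 1, ⟨u - 1, by omega⟩⟩ := rfl

/-- A potential for the adaptive algorithm: its value depends on the number `q` of samples and on
the state, and is `e q goal count` at the end and `g q goal count r c` when the next sample is
taken on an interval with `r` elements of the hidden set and `c` more chains have to be run
afterwards. -/
def potential (S : Finset (Fin (m + 1))) (g : ℕ → ℕ → ℕ → ℕ → ℕ → ℝ) (e : ℕ → ℕ → ℕ → ℝ) (q : ℕ)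
    (s : State m) : ℝ :=
  if s.left = 0 then e q s.goal s.count
  else g q s.goal s.count (S ∩ (initial s.last).elems).card (s.left - 1)

/-- Invariants of an execution after `q` samples: each counted answer is a sample, and the algorithm
does not stop during the pilot phase. -/
def Valid (q : ℕ) (s : State m) : Prop := s.count ≤ q ∧ (s.left = 0 → s.goal ≠ 0)

/-- The potential argument, reduced to the inequalities for one round and for the changes between
chains. -/
theorem law_history_le (S : Finset (Fin (m + 1))) (ε : ℝ) (hR : ∀ t, mainChains ε t ≠ 0)
    (g : ℕ → ℕ → ℕ → ℕ → ℕ → ℝ) (e : ℕ → ℕ → ℕ → ℝ)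
    (hg0 : ∀ q G t r c, 0 ≤ g q G t r c) (he0 : ∀ q G t, 0 ≤ e q G t)
    (hstep : ∀ q G t r c, ∑ j ∈ Finset.range r, g (q + 1) G (t + 1) j c ≤ r * g q G t r c)
    (hchain : ∀ q q' G t c, q' ≤ q + 1 → g q' G t S.card c ≤ g q G t 0 (c + 1))
    (hend : ∀ q q' G t, G ≠ 0 → q' ≤ q + 1 → e q' G t ≤ g q G t 0 0)
    (hmain : ∀ q q' t, q' ≤ q + 1 → t ≤ q' →
      g q' (mainChains ε t) 0 S.card (mainChains ε t - 1) ≤ g q 0 t 0 0)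
    (bad : List (Answer (m + 1)) → Prop)
    (hbad : ∀ h, Valid h.length (state (mainChains ε) h) → bad h →
      1 ≤ potential S g e h.length (state (mainChains ε) h)) (t : ℕ) :
    (algorithm m ε).law S {z | bad ((algorithm m ε).history z t)} ≤
      ENNReal.ofReal (g 0 0 0 S.card 24) := by
  set R := mainChains ε with hRdef
  -- ending a chain does not increase the potential
  have hE : ∀ (q q' : ℕ) (s : State m), s.left ≠ 0 → q' ≤ q + 1 → s.count ≤ q' →
      Valid q' (endChain R s) ∧
      potential S g e q' (endChain R s) ≤ g q s.goal s.count 0 (s.left - 1) := by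
    intro q q' s hl hq hc
    unfold endChain
    split_ifs with hcase
    · obtain ⟨h1, h2⟩ := hcase
      refine ⟨⟨Nat.zero_le _, fun h => absurd h (hR _)⟩, ?_⟩
      rw [potential, if_neg (hR _), inter_initial_last, h1, h2]
      exact hmain q q' _ hq hc
    · refine ⟨⟨hc, fun h => ?_⟩, ?_⟩
      · simp only at h ⊢
        omega
      · obtain ⟨c, hc'⟩ : ∃ c, s.left = c + 1 := ⟨s.left - 1, by omega⟩
        rw [potential]
        simp only [inter_initial_last, hc', Nat.add_sub_cancel]
        rcases c with _ | c
        · simp only [if_true]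
          exact hend q q' _ _ (by omega) hq
        · simp only [Nat.succ_ne_zero, if_false, Nat.add_sub_cancel]
          exact hchain q q' _ _ c hq
  have h0 : potential S g e 0 (state (m := m) R []) = g 0 0 0 S.card 24 := by
    simp [state, init, potential, inter_initial_last]
  rw [← h0]
  refine (SampleAlgorithm.law_history_le bad t ∅ _ fun ω _ => ?_).trans
    (le_of_eq (by rw [measure_empty, add_zero]))
  refine SampleAlgorithm.answerLaw_history_le (A := algorithm m ε)
    (fun h => Valid h.length (state R h)) (fun h => potential S g e h.length (state R h))
    ⟨Nat.zero_le _, fun h => by simp [state, init] at h⟩ ?_ ?_ ?_ bad hbad t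
  · intro h _
    simp only [potential]
    split_ifs
    · exact he0 _ _ _
    · exact hg0 _ _ _ _ _
  all_goals
    intro h T hv hT hST
    have hT' : action ε (state R h) = Sum.inl T := hT
    simp only [state_append, List.length_append, List.length_singleton]
    generalize state R h = s at hv hT' ⊢
    generalize h.length = q at hv
    unfold action at hT'
    split_ifs at hT' with hl
    obtain rfl := Sum.inl.inj hT'
    obtain ⟨hv1, hv2⟩ := hv
  · rw [next_miss]
    refine (hE q (q + 1) s hl le_rfl (by omega)).imp_right fun h1 => h1.trans (le_of_eq ?_)
    rw [potential, if_neg hl, hST, Finset.card_empty]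
  · set A := S ∩ (initial s.last).elems with hA
    have hone : ∀ u ∈ A, Valid (q + 1) (next R s (hit u)) ∧
        potential S g e (q + 1) (next R s (hit u)) ≤
          g (q + 1) s.goal (s.count + 1) (A.filter (· < u)).card (s.left - 1) := by
      intro u hu
      rw [next_hit]
      split_ifs with hu0
      · refine (hE (q + 1) (q + 1) ⟨s.goal, s.left, s.count + 1, s.last⟩ hl (by omega)
          (by simpa using hv1)).imp_right fun h1 => h1.trans (le_of_eq ?_)
        simp [hu0]
      · refine ⟨⟨by simpa using hv1, fun h => absurd h hl⟩, le_of_eq ?_⟩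
        rw [potential, if_neg hl]
        congr 2
        rw [hA, inter_initial, inter_initial, Finset.filter_filter]
        refine Finset.filter_congr fun v _ => ?_
        have h1 : u ≤ s.last := mem_elems_initial.1 (Finset.mem_inter.1 hu).2
        have h2 : (u : ℕ) ≠ 0 := fun h => hu0 (Fin.ext h)
        simp only [Fin.le_def, Fin.lt_def] at h1 ⊢
        omega
    refine ⟨fun u hu => (hone u hu).1, ?_⟩
    refine (Finset.sum_le_sum fun u hu => (hone u hu).2).trans ?_
    rw [sum_rank A fun j => g (q + 1) s.goal (s.count + 1) j (s.left - 1), potential, if_neg hl]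
    exact hstep _ _ _ _ _

end Records

namespace Records

variable {m : ℕ}

lemma mainChains_ne_zero {ε : ℝ} (hε : 0 < ε) (t : ℕ) : mainChains ε t ≠ 0 := by
  have : 0 < mainChains ε t := Nat.ceil_pos.2 (by positivity)
  omega

lemma mainChains_mono (ε : ℝ) : Monotone (mainChains ε) := fun a b hab => by
  have : (a : ℝ) ≤ b := by exact_mod_cast hab
  exact Nat.ceil_mono (by gcongr)

lemma sum_min_one_le (r : ℕ) (f : ℕ → ℝ) (x : ℝ) (h : ∑ j ∈ Finset.range r, f j ≤ r * x) :
    ∑ j ∈ Finset.range r, min 1 (f j) ≤ r * min 1 x := by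
  rw [mul_min_of_nonneg _ _ (Nat.cast_nonneg r)]
  refine le_min ?_ ((Finset.sum_le_sum fun j _ => min_le_right _ _).trans h)
  exact (Finset.sum_le_sum fun j _ => min_le_left _ _).trans (by simp)

/-- The count of a chain that starts with `r` elements has mean `harm r` and variance at most
`harm r`: the compensated square does not increase in expectation. -/
lemma sum_sq_add_le (r : ℕ) (d b : ℝ) :
    ∑ j ∈ Finset.range r, ((d + 1 + harm j) ^ 2 + (harm j + b)) ≤
      r * ((d + harm r) ^ 2 + (harm r + b)) := by
  have h1 : ∀ j, (d + 1 + harm j) ^ 2 + (harm j + b) =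
      ((d + harm r + 1) ^ 2 - 2 * (d + harm r + 1) * harm r + b) +
        (2 * (d + harm r + 1) + 1) * harm j + (harm r - harm j) ^ 2 := by
    intro j; ring
  rw [Finset.sum_congr rfl fun j _ => h1 j, Finset.sum_add_distrib, Finset.sum_add_distrib,
    ← Finset.mul_sum, sum_harm]
  have h2 := sum_sq_harm_sub r
  simp only [Finset.sum_const, Finset.card_range, nsmul_eq_mul]
  nlinarith

/-- The potential for the error: the second moment of the deviation of the count from its mean,
relative to the allowed deviation. The summand `2 / 25` pays for the main phase. -/
def errorPotential (H ε : ℝ) (_q G t r c : ℕ) : ℝ :=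
  if G = 0 then
    ((t - 25 * H + c * H + harm r) ^ 2 + (harm r + c * H)) / (25 / 2 * H) ^ 2 + 2 / 25
  else min 1 (((t - G * H + c * H + harm r) ^ 2 + (harm r + c * H)) / (ε * G / 4) ^ 2)

/-- The value of the potential for the error at the end. -/
def errorEnd (H ε : ℝ) (_q G t : ℕ) : ℝ := min 1 ((t - G * H) ^ 2 / (ε * G / 4) ^ 2)

/-- The estimate is accurate if the average count `x` is close to the harmonic number of `w`. -/
lemma le_estimate {w : ℕ} {ε x : ℝ} (h0 : 0 < ε) (h1 : ε ≤ 1) (h : |harm w - x| ≤ ε / 4) :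
    1 / (1 + ε) * (w : ℝ) ≤ estimate ε x ∧ estimate ε x ≤ (1 + ε) * (w : ℝ) := by
  have hex : ∃ k : ℕ, |harm k - x| ≤ ε / 4 := ⟨w, h⟩
  rw [estimate, dif_pos hex]
  have h2 := hex.choose_spec
  set k := hex.choose
  rw [abs_le] at h h2
  refine ⟨?_, le_of_harm_le h0 h1 (by linarith)⟩
  rw [one_div, inv_mul_le_iff₀ (by linarith)]
  exact le_of_harm_le h0 h1 (by linarith)

lemma law_error_le (S : Finset (Fin (m + 1))) {ε : ℝ} (h0 : 0 < ε) (h1 : ε ≤ 1) (t : ℕ) :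
    (algorithm m ε).law S {z | ∃ v, (algorithm m ε).step z.1 ((algorithm m ε).history z t) =
      Sum.inr v ∧ ¬ (1 / (1 + ε) * (S.card : ℝ) ≤ v ∧ v ≤ (1 + ε) * (S.card : ℝ))} ≤
      ENNReal.ofReal (1 / 4) := by
  set H := harm S.card with hH
  have hHn : 0 ≤ H := harm_nonneg _
  have key := law_history_le S ε (mainChains_ne_zero h0) (errorPotential H ε) (errorEnd H ε)
    (fun q G t r c => by
      have := harm_nonneg r
      unfold errorPotential; split_ifs <;> positivity)
    (fun q G t => by unfold errorEnd; positivity)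
    (fun q G t r c => by
      have h2 := sum_sq_add_le r (t - 25 * H + c * H) (c * H)
      have h3 := sum_sq_add_le r (t - G * H + c * H) (c * H)
      unfold errorPotential
      split_ifs with hG
      · rw [Finset.sum_add_distrib, ← Finset.sum_div, mul_add]
        simp only [Finset.sum_const, Finset.card_range, nsmul_eq_mul]
        gcongr
        rw [← mul_div_assoc]
        gcongr
        refine le_trans (le_of_eq ?_) h2
        refine Finset.sum_congr rfl fun j _ => ?_
        push_cast; ring
      · refine sum_min_one_le r _ _ ?_
        rw [← Finset.sum_div, ← mul_div_assoc]
        gcongr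
        refine le_trans (le_of_eq ?_) h3
        refine Finset.sum_congr rfl fun j _ => ?_
        push_cast; ring)
    (fun q q' G t c _ => by
      unfold errorPotential
      rw [harm_zero]
      push_cast
      rw [← hH]
      refine le_of_eq ?_
      congr 1 <;> ring_nf)
    (fun q q' G t hG _ => by
      unfold errorPotential errorEnd
      rw [harm_zero, if_neg hG]
      simp)
    (fun q q' t _ _ => by
      have hR := mainChains_ne_zero h0 t
      unfold errorPotential
      rw [if_neg hR, if_pos rfl, harm_zero, ← hH]
      obtain ⟨N, hN⟩ : ∃ N, mainChains ε t = N + 1 := ⟨_, (Nat.succ_pred_eq_of_ne_zero hR).symm⟩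
      have hge : 16 * ((t : ℝ) + 1) / ε ^ 2 ≤ (N : ℝ) + 1 := by
        have := Nat.le_ceil (16 * ((t : ℝ) + 1) / ε ^ 2)
        rw [← mainChains, hN] at this
        exact_mod_cast this
      rw [hN, Nat.add_sub_cancel]
      push_cast
      have hz : (0 - ((N : ℝ) + 1) * H + N * H + H) ^ 2 + (H + N * H) = ((N : ℝ) + 1) * H := by
        ring
      rw [hz]
      -- either the main phase is long enough, or the pilot count is too far from its mean
      rcases le_or_gt (25 / 2 * H) t with ht | ht
      · refine (min_le_right _ _).trans ?_
        have h2 : ((N : ℝ) + 1) * H / (ε * (N + 1) / 4) ^ 2 ≤ 2 / 25 := by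
          rw [div_le_iff₀ (by positivity)] at hge ⊢
          have h3 : H ≤ 2 / 25 * ((t : ℝ) + 1) := by linarith
          nlinarith [Nat.cast_nonneg (α := ℝ) N]
        have h4 : 0 ≤ (((t : ℝ) - 25 * H + ↑(0 : ℕ) * H + 0) ^ 2 + (0 + ↑(0 : ℕ) * H)) /
          (25 / 2 * H) ^ 2 := by positivity
        simp only [Nat.cast_zero] at h4
        linarith
      · refine (min_le_left _ _).trans ?_
        have hpos : 0 < H := by nlinarith [Nat.cast_nonneg (α := ℝ) t]
        have h2 : 1 ≤ (((t : ℝ) - 25 * H + 0 * H + 0) ^ 2 + (0 + 0 * H)) / (25 / 2 * H) ^ 2 := by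
          rw [le_div_iff₀ (by positivity)]
          nlinarith
        linarith)
    (fun h => ∃ v, action ε (state (mainChains ε) h) = Sum.inr v ∧
      ¬ (1 / (1 + ε) * (S.card : ℝ) ≤ v ∧ v ≤ (1 + ε) * (S.card : ℝ)))
    (fun h hv ⟨v, hva, hvb⟩ => by
      generalize state (mainChains ε) h = s at hv hva ⊢
      unfold action at hva
      split_ifs at hva with hl
      obtain rfl := Sum.inr.inj hva
      rw [potential, if_pos hl, errorEnd]
      refine le_min le_rfl ?_
      by_contra hcon
      push Not at hcon
      have hG : 0 < (s.goal : ℝ) := by exact_mod_cast Nat.pos_of_ne_zero (hv.2 hl)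
      refine hvb (le_estimate h0 h1 ?_)
      rw [div_lt_one (by positivity)] at hcon
      have h2 := (abs_lt_of_sq_lt_sq hcon (by positivity)).le
      have h3 : harm S.card - s.count / s.goal = -((s.count - s.goal * H) / s.goal) := by
        rw [← hH]; field_simp; ring
      rw [h3, abs_neg, abs_div, abs_of_pos hG, div_le_iff₀ hG]
      linarith) t
  refine key.trans (ENNReal.ofReal_le_ofReal ?_)
  unfold errorPotential
  rw [if_pos rfl, ← hH]
  have h2 : ((0 : ℝ) - 25 * H + (24 : ℕ) * H + H) ^ 2 + (H + (24 : ℕ) * H) = 25 * H := by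
    push_cast; ring
  rw [Nat.cast_zero, h2]
  rcases Nat.eq_zero_or_pos S.card with hw | hw
  · have : H = 0 := by rw [hH, hw, harm_zero]
    norm_num [this]
  · have : 1 ≤ H := one_le_harm hw
    have h3 : 25 * H / (25 / 2 * H) ^ 2 ≤ 4 / 25 := by
      rw [div_le_iff₀ (by positivity)]; nlinarith
    linarith

/-- The potential for the number of samples. Since the count of a chain with `r` elements has the
exponential moment `E 2^count = r + 1`, each chain contributes a factor `P = 2 * (|S| + 1)`; the
pilot phase is unlikely to exceed `z` samples, and then the main phase is unlikely to exceed `X`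
samples in total. -/
def timePotential (z X N : ℕ) (P : ℝ) (q G _t r c : ℕ) : ℝ :=
  if G = 0 then 2 ^ q / 2 ^ z * (2 * (r + 1)) * P ^ c + 2 ^ z / 2 ^ X * P ^ N
  else min 1 (2 ^ q / 2 ^ X * (2 * (r + 1)) * P ^ c)

/-- The value of the potential for the number of samples at the end. -/
def timeEnd (X q _G _t : ℕ) : ℝ := min 1 (2 ^ q / 2 ^ X)

lemma sum_two_pow (r q : ℕ) (a b : ℝ) :
    ∑ j ∈ Finset.range r, 2 ^ (q + 1) / a * (2 * ((j : ℝ) + 1)) * b =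
      r * (2 ^ q / a * (2 * ((r : ℝ) + 1)) * b) := by
  have h1 : ∑ j ∈ Finset.range r, 2 * ((j : ℝ) + 1) = r * (r + 1) := by
    induction r with
    | zero => simp
    | succ r ih => rw [Finset.sum_range_succ, ih]; push_cast; ring
  rw [← Finset.sum_mul, ← Finset.mul_sum, h1, pow_succ]
  ring

lemma law_time_le (S : Finset (Fin (m + 1))) {ε : ℝ} (h0 : 0 < ε) (z X : ℕ) (hzX : z ≤ X) :
    (algorithm m ε).law S {y | ((algorithm m ε).history y X).length = X} ≤
      ENNReal.ofReal ((2 * ((S.card : ℝ) + 1)) ^ 25 / 2 ^ z +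
        2 ^ z / 2 ^ X * (2 * ((S.card : ℝ) + 1)) ^ (mainChains ε z)) := by
  set P : ℝ := 2 * ((S.card : ℝ) + 1) with hP
  have hP1 : 1 ≤ P := by rw [hP]; linarith [Nat.cast_nonneg (α := ℝ) S.card]
  have key := law_history_le S ε (mainChains_ne_zero h0) (timePotential z X (mainChains ε z) P)
    (timeEnd X)
    (fun q G t r c => by unfold timePotential; split_ifs <;> positivity)
    (fun q G t => by unfold timeEnd; positivity)
    (fun q G t r c => by
      unfold timePotential
      split_ifs with hG
      · rw [Finset.sum_add_distrib, sum_two_pow, mul_add, Finset.sum_const, Finset.card_range,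
          nsmul_eq_mul]
        exact (mul_add _ _ _).ge
      · exact sum_min_one_le r _ _ (sum_two_pow r q _ _).le)
    (fun q q' G t c hq => by
      have hpow : (2 : ℝ) ^ q' ≤ 2 ^ q * 2 := by
        rw [← pow_succ]; exact pow_le_pow_right₀ one_le_two hq
      have h2 : ∀ a : ℝ, 0 < a → 2 ^ q' / a * P * P ^ c ≤
          2 ^ q / a * (2 * ((0 : ℕ) + 1)) * P ^ (c + 1) := by
        intro a ha
        rw [pow_succ]
        calc 2 ^ q' / a * P * P ^ c ≤ (2 ^ q * 2) / a * P * P ^ c := by gcongr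
          _ = _ := by push_cast; ring
      unfold timePotential
      rw [← hP]
      split_ifs with hG
      · gcongr ?_ + _
        exact h2 _ (by positivity)
      · exact min_le_min le_rfl (h2 _ (by positivity)))
    (fun q q' G t hG hq => by
      have hpow : (2 : ℝ) ^ q' ≤ 2 ^ q * 2 := by
        rw [← pow_succ]; exact pow_le_pow_right₀ one_le_two hq
      unfold timePotential timeEnd
      rw [if_neg hG]
      refine min_le_min le_rfl ?_
      calc (2 : ℝ) ^ q' / 2 ^ X ≤ (2 ^ q * 2) / 2 ^ X := by gcongr
        _ = _ := by push_cast; ring)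
    (fun q q' t hq ht => by
      have hR := mainChains_ne_zero h0 t
      unfold timePotential
      rw [if_neg hR, if_pos rfl, ← hP]
      obtain ⟨N, hN⟩ : ∃ N, mainChains ε t = N + 1 := ⟨_, (Nat.succ_pred_eq_of_ne_zero hR).symm⟩
      -- either the pilot phase was too long, or the main phase has at most `mainChains ε z` chains
      rcases le_or_gt z q' with hz | hz
      · refine (min_le_left _ _).trans ?_
        have h2 : (2 : ℝ) ^ z ≤ 2 ^ (q + 1) := pow_le_pow_right₀ one_le_two (hz.trans hq)
        have h3 : 1 ≤ (2 : ℝ) ^ q / 2 ^ z * (2 * ((0 : ℕ) + 1)) * P ^ 0 := by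
          rw [pow_succ] at h2
          rw [pow_zero, mul_one, Nat.cast_zero, zero_add, mul_one, div_mul_eq_mul_div,
            le_div_iff₀ (by positivity), one_mul]
          exact h2
        have h4 : 0 ≤ (2 : ℝ) ^ z / 2 ^ X * P ^ (mainChains ε z) := by positivity
        linarith
      · refine (min_le_right _ _).trans ?_
        have h2 : P ^ (mainChains ε t) ≤ P ^ (mainChains ε z) :=
          pow_le_pow_right₀ hP1 (mainChains_mono ε (by omega))
        have h3 : 2 ^ q' / 2 ^ X * P * P ^ (mainChains ε t - 1) =
            2 ^ q' / 2 ^ X * P ^ (mainChains ε t) := by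
          rw [hN, Nat.add_sub_cancel, pow_succ]; ring
        rw [h3]
        have h4 : (2 : ℝ) ^ q' ≤ 2 ^ z := pow_le_pow_right₀ one_le_two hz.le
        have h5 : 2 ^ q' / 2 ^ X * P ^ (mainChains ε t) ≤
            2 ^ z / 2 ^ X * P ^ (mainChains ε z) := by gcongr
        have h6 : 0 ≤ (2 : ℝ) ^ q / 2 ^ z * (2 * ((0 : ℕ) + 1)) * P ^ 0 := by positivity
        linarith)
    (fun h => h.length = X)
    (fun h hv hX => by
      rw [hX] at hv ⊢
      generalize state (mainChains ε) h = s at hv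
      have hX1 : (2 : ℝ) ^ X / 2 ^ X = 1 := div_self (by positivity)
      unfold potential timePotential timeEnd
      rw [hX1]
      split_ifs with hl hG
      · simp
      · have h2 : (1 : ℝ) ≤ 2 ^ X / 2 ^ z := by
          rw [le_div_iff₀ (by positivity), one_mul]
          exact pow_le_pow_right₀ one_le_two hzX
        have h3 : (1 : ℝ) ≤ 2 * (((S ∩ (initial s.last).elems).card : ℝ) + 1) := by
          linarith [Nat.cast_nonneg (α := ℝ) (S ∩ (initial s.last).elems).card]
        have h4 := one_le_mul_of_one_le_of_one_le (one_le_mul_of_one_le_of_one_le h2 h3)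
          (one_le_pow₀ hP1 (n := s.left - 1))
        have h5 : 0 ≤ (2 : ℝ) ^ z / 2 ^ X * P ^ (mainChains ε z) := by positivity
        linarith
      · refine le_min le_rfl ?_
        have h3 : (1 : ℝ) ≤ 2 * (((S ∩ (initial s.last).elems).card : ℝ) + 1) := by
          linarith [Nat.cast_nonneg (α := ℝ) (S ∩ (initial s.last).elems).card]
        rw [one_mul]
        exact one_le_mul_of_one_le_of_one_le h3 (one_le_pow₀ hP1)) X
  refine key.trans (le_of_eq ?_)
  unfold timePotential
  rw [if_pos rfl, ← hP]
  congr 1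
  ring

lemma two_mul_succ_le_exp (w : ℕ) : 2 * ((w : ℝ) + 1) ≤ Real.exp (2 * (1 + Real.log w)) := by
  have he : (2 : ℝ) ≤ Real.exp 1 := by have := Real.exp_one_gt_d9; linarith
  have h2 : (4 : ℝ) ≤ Real.exp 2 := by
    have : Real.exp 2 = Real.exp 1 * Real.exp 1 := by rw [← Real.exp_add]; norm_num
    nlinarith
  rcases Nat.eq_zero_or_pos w with rfl | hw
  · simp; linarith
  · have hw1 : (1 : ℝ) ≤ w := by exact_mod_cast hw
    have : Real.exp (2 * (1 + Real.log w)) = Real.exp 2 * (w * w) := by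
      rw [mul_add, Real.exp_add, mul_one, two_mul (Real.log w), Real.exp_add,
        Real.exp_log (by linarith)]
    rw [this]
    nlinarith

lemma exp_half_le_two_pow (d : ℕ) : Real.exp ((d : ℝ) / 2) ≤ 2 ^ d := by
  have h1 : Real.exp (1 / 2) ≤ 2 := by
    have h2 : Real.exp (1 / 2) * Real.exp (1 / 2) = Real.exp 1 := by
      rw [← Real.exp_add]; norm_num
    have h3 := Real.exp_one_lt_d9
    nlinarith [Real.exp_pos (1 / 2)]
  calc Real.exp ((d : ℝ) / 2) = Real.exp (1 / 2) ^ d := by rw [← Real.exp_nat_mul]; ring_nf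
    _ ≤ 2 ^ d := by gcongr

lemma exp_le_half {x k : ℝ} (h : x ≤ -k - 1) : Real.exp x ≤ Real.exp (-k) / 2 := by
  have he : (2 : ℝ) ≤ Real.exp 1 := by have := Real.exp_one_gt_d9; linarith
  have h1 : Real.exp x ≤ Real.exp (-k - 1) := Real.exp_le_exp.2 h
  rw [Real.exp_sub] at h1
  exact h1.trans (by gcongr)

/-- The number of samples is at most `O(k (1 + log |S|)² / ε²)`, except with probability
`exp (-k)`. -/
lemma exists_law_length_le (S : Finset (Fin (m + 1))) {ε : ℝ} (h0 : 0 < ε) (h1 : ε ≤ 1) {k : ℝ}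
    (hk : 1 ≤ k) :
    ∃ X : ℕ, (X : ℝ) ≤ k * (7000 * (1 + Real.log S.card) ^ 2 / ε ^ 2) ∧
      (algorithm m ε).law S {y | ((algorithm m ε).history y X).length = X} ≤
        ENNReal.ofReal (Real.exp (-k)) := by
  set l : ℝ := 1 + Real.log S.card with hl
  have hl1 : 1 ≤ l := by linarith [Real.log_natCast_nonneg S.card]
  have hkl : 1 ≤ k * l := by nlinarith
  -- a factor `P` of the potential is at most `exp (2 * l)`, and each sample gains at least
  -- `exp (1 / 2)`: `z` pays for the `25` pilot chains, and `D` for the chains of the main phase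
  set z : ℕ := ⌈104 * (k * l)⌉₊ with hz
  have hz1 : 104 * (k * l) ≤ z := Nat.le_ceil _
  have hz2 : (z : ℝ) ≤ 105 * (k * l) := by
    have := Nat.ceil_lt_add_one (a := 104 * (k * l)) (by positivity)
    linarith
  set N := mainChains ε z with hN
  have he : 1 ≤ 1 / ε ^ 2 := by
    rw [le_div_iff₀ (by positivity)]; nlinarith
  set i : ℝ := 1 / ε ^ 2 with hi
  have hN2 : (N : ℝ) ≤ 1697 * (k * l) * i := by
    have := Nat.ceil_lt_add_one (a := 16 * ((z : ℝ) + 1) / ε ^ 2) (by positivity)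
    rw [← mainChains, ← hN] at this
    have h3 : 16 * ((z : ℝ) + 1) / ε ^ 2 = 16 * ((z : ℝ) + 1) * i := by rw [hi]; ring
    rw [h3] at this
    have h4 : 16 * ((z : ℝ) + 1) ≤ 1696 * (k * l) := by linarith
    nlinarith
  set D : ℕ := ⌈4 * l * N + 2 * k + 2⌉₊ with hD
  have hD1 : 4 * l * N + 2 * k + 2 ≤ D := Nat.le_ceil _
  have hD2 : (D : ℝ) ≤ 4 * l * N + 2 * k + 3 := by
    have := Nat.ceil_lt_add_one (a := 4 * l * N + 2 * k + 2) (by positivity)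
    linarith
  refine ⟨z + D, ?_, (law_time_le S h0 z (z + D) (by omega)).trans
    (ENNReal.ofReal_le_ofReal ?_)⟩
  · have h3 : k * (7000 * l ^ 2 / ε ^ 2) = 7000 * (k * l) * l * i := by rw [hi]; ring
    rw [h3]
    push_cast
    have h4 : l * N ≤ 1697 * (k * l) * l * i := by nlinarith
    have h5 : k * l ≤ (k * l) * l * i := by
      have : 1 ≤ l * i := one_le_mul_of_one_le_of_one_le hl1 he
      nlinarith
    have h6 : k ≤ k * l := by nlinarith
    linarith
  · set P : ℝ := 2 * ((S.card : ℝ) + 1) with hP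
    have hPexp : P ≤ Real.exp (2 * l) := two_mul_succ_le_exp _
    have hP0 : 0 < P := by positivity
    have hpow : ∀ n d : ℕ, n * (2 * l) - d / 2 ≤ -k - 1 → P ^ n / 2 ^ d ≤ Real.exp (-k) / 2 := by
      intro n d hnd
      refine le_trans ?_ (exp_le_half hnd)
      rw [Real.exp_sub, Real.exp_nat_mul]
      gcongr
      exact exp_half_le_two_pow d
    have h3 := hpow 25 z (by push_cast; nlinarith)
    have h4 := hpow N D (by nlinarith)
    have h5 : (2 : ℝ) ^ z / 2 ^ (z + D) * P ^ N = P ^ N / 2 ^ D := by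
      rw [pow_add]; field_simp
    rw [h5]
    linarith

end Records

lemma exp_neg_three_le : Real.exp (-3) ≤ 1 / 12 := by
  have h1 : (12 : ℝ) ≤ Real.exp 3 := by
    have h2 : Real.exp 3 = Real.exp 1 ^ 3 := by rw [← Real.exp_nat_mul]; norm_num
    have h3 : (2.5 : ℝ) ≤ Real.exp 1 := by have := Real.exp_one_gt_d9; linarith
    rw [h2]
    calc (12 : ℝ) ≤ 2.5 ^ 3 := by norm_num
      _ ≤ _ := by gcongr
  rw [Real.exp_neg, one_div]
  gcongr

namespace Records

variable {m : ℕ}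

theorem isSetSizeApprox_algorithm {ε : ℝ} (h0 : 0 < ε) (h1 : ε ≤ 1) :
    (algorithm m ε).IsSetSizeApprox ε := by
  intro S
  obtain ⟨X, -, hX⟩ := exists_law_length_le S h0 h1 (k := 3) (by norm_num)
  refine SampleAlgorithm.le_law_outputs _ X (Real.exp (-3)) (1 / 4) (by positivity) (by norm_num)
    ?_ hX (law_error_le S h0 h1 X)
  linarith [exp_neg_three_le]

end Records

/-- The algorithm that stops at once with the estimate `0`. -/
def trivialAlgorithm (n : ℕ) : SampleAlgorithm n where
  Coins := Unit
  coinLaw := Measure.dirac ()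
  step _ _ := Sum.inr 0
  measurable_step _ := measurable_const

lemma isSetSizeApprox_trivialAlgorithm (ε : ℝ) : (trivialAlgorithm 0).IsSetSizeApprox ε := by
  intro S
  have hS : S.card = 0 := by rw [Finset.eq_empty_of_isEmpty S]; rfl
  have : {z : (trivialAlgorithm 0).Outcome | ∃ v : ℝ, (trivialAlgorithm 0).Outputs z v ∧
      1 / (1 + ε) * (S.card : ℝ) ≤ v ∧ v ≤ (1 + ε) * (S.card : ℝ)} = Set.univ := by
    refine Set.eq_univ_of_forall fun z => ⟨0, ⟨0, rfl⟩, ?_⟩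
    simp [hS]
  rw [this, measure_univ, ENNReal.ofReal_le_one]
  norm_num

theorem exists_adaptive_upper_bound : ∃ (C : ℝ) (a : ℕ), 0 < C ∧
      ∀ (n : ℕ) (ε : ℝ), 0 < ε → ε ≤ 1 →
        ∃ A : SampleAlgorithm n, A.IsSetSizeApprox ε ∧
          ∀ S : Finset (Fin n), S.Nonempty → ∀ k : ℝ, 1 ≤ k →
            A.law S
              {z | ENNReal.ofReal
                    (k * (C * (1 + Real.log (S.card : ℝ)) ^ 4
                      * (1 + Real.log (1 + Real.log (S.card : ℝ))) ^ a / ε ^ 2))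
                    < A.sampleCount z}
              ≤ ENNReal.ofReal (Real.exp (-k)) := by
  refine ⟨7000, 0, by norm_num, fun n ε h0 h1 => ?_⟩
  rcases n with _ | m
  · refine ⟨trivialAlgorithm 0, isSetSizeApprox_trivialAlgorithm ε, fun S hS => ?_⟩
    obtain ⟨u, -⟩ := hS
    exact u.elim0
  · refine ⟨Records.algorithm m ε, Records.isSetSizeApprox_algorithm h0 h1, fun S _ k hk => ?_⟩
    obtain ⟨X, hX1, hX2⟩ := Records.exists_law_length_le S h0 h1 hk
    refine (SampleAlgorithm.law_lt_sampleCount_le (hX1.trans ?_)).trans hX2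
    have hl1 : 1 ≤ 1 + Real.log S.card := by linarith [Real.log_natCast_nonneg S.card]
    rw [pow_zero, mul_one]
    gcongr
    norm_num

/-! ### Repetitions and single elements: the non-adaptive algorithm -/

/-- An event that is incompatible with an invariant has probability zero. -/
lemma SampleAlgorithm.answerLaw_history_eq_zero {n : ℕ} {A : SampleAlgorithm n}
    {S : Finset (Fin n)} {ω : A.Coins} (Inv : List (Answer n) → Prop) (hInv0 : Inv [])
    (hmiss : ∀ h T, Inv h → A.step ω h = Sum.inl T → S ∩ T.elems = ∅ → Inv (h ++ [miss]))
    (hhit : ∀ h T, Inv h → A.step ω h = Sum.inl T →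
      ∀ u ∈ S ∩ T.elems, Inv (h ++ [hit u]))
    (bad : List (Answer n) → Prop) (hbad : ∀ h, Inv h → ¬ bad h) (t : ℕ) :
    answerLaw S {y | bad (A.history (ω, y) t)} = 0 := by
  have := answerLaw_history_le (A := A) (S := S) (ω := ω) Inv (fun _ => 0) hInv0
    (fun _ _ => le_rfl) (fun h T hi hT he => ⟨hmiss h T hi hT he, le_rfl⟩)
    (fun h T hi hT _ => ⟨hhit h T hi hT, by simp⟩) bad
    (fun h hi hb => absurd hb (hbad h hi)) t
  simpa using this

/-- A sum over the elements of which those with property `p` halve the summand. -/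
lemma sum_ite_half {α : Type*} (A : Finset α) (p : α → Prop) [DecidablePred p] (c : ℝ) :
    ∑ u ∈ A, (if p u then c / 2 else c) = (A.card - (A.filter p).card / 2) * c := by
  have h1 : ∀ u, (if p u then c / 2 else c) = c - (if p u then c / 2 else 0) := by
    intro u; split_ifs <;> ring
  rw [Finset.sum_congr rfl fun u _ => h1 u, Finset.sum_sub_distrib, ← Finset.sum_filter]
  simp only [Finset.sum_const, nsmul_eq_mul]
  ring

/-- One round of a counting process with success probability `D / N`, where `D` is the number of
elements with property `p`: the compensated square, plus a reward for each remaining success, does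
not increase in expectation. -/
lemma sum_ite_sq_le {α : Type*} (A : Finset α) (p : α → Prop) [DecidablePred p] (M κ : ℝ) :
    ∑ u ∈ A, (if p u then (M + A.card - (A.filter p).card) ^ 2 + (A.card : ℝ) ^ 2 * (κ - 1)
      else (M - (A.filter p).card) ^ 2 + (A.card : ℝ) ^ 2 * κ) ≤
      A.card * (M ^ 2 + (A.card : ℝ) ^ 2 * κ) := by
  set N : ℝ := (A.card : ℝ)
  set D : ℝ := ((A.filter p).card : ℝ) with hD
  have h1 : ∀ u, (if p u then (M + N - D) ^ 2 + N ^ 2 * (κ - 1) else (M - D) ^ 2 + N ^ 2 * κ) =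
      ((M - D) ^ 2 + N ^ 2 * κ) + (if p u then 2 * N * (M - D) else 0) := by
    intro u; split_ifs <;> ring
  rw [Finset.sum_congr rfl fun u _ => h1 u, Finset.sum_add_distrib, ← Finset.sum_filter]
  simp only [Finset.sum_const, nsmul_eq_mul]
  rw [← hD]
  have hN : (A.card : ℝ) = N := rfl
  rw [hN]
  have : 0 ≤ N * D ^ 2 := by positivity
  nlinarith

namespace Repetitions

variable {m : ℕ}

/-- The state of the non-adaptive algorithm on the universe `Fin (m + 1)`, which alternates
between samples on the whole universe and on single random elements. -/
structure State (m : ℕ) where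
  /-- whether the next sample is taken on a single element -/
  single : Bool
  /-- the elements seen in the samples on the universe -/
  seen : Finset (Fin (m + 1))
  /-- the number of samples on the universe that did not show a new element; the indication of an
  empty intersection counts, so that the algorithm stops if nothing is hidden -/
  reps : ℕ
  /-- the sum, over all samples on the universe, of the number of elements seen before -/
  weight : ℕ
  /-- the number of sampled single elements that were in the hidden set -/
  hits : ℕ
  /-- the number of samples on single elements -/
  rounds : ℕ

/-- The state after an answer. -/
def next (s : State m) (a : Answer (m + 1)) : State m :=
  if s.single then
    ⟨false, s.seen, s.reps, s.weight, s.hits + (if a = miss then 0 else 1), s.rounds + 1⟩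
  else if ∃ u, u ∉ s.seen ∧ a = hit u then
    ⟨true, s.seen ∪ Finset.univ.filter (fun u => a = hit u), s.reps, s.weight + s.seen.card,
      s.hits, s.rounds⟩
  else ⟨true, s.seen, s.reps + 1, s.weight + s.seen.card, s.hits, s.rounds⟩

/-- The state after a list of answers. -/
def state (h : List (Answer (m + 1))) : State m := h.foldl next ⟨false, ∅, 0, 0, 0, 0⟩

lemma state_append (h : List (Answer (m + 1))) (a : Answer (m + 1)) :
    state (h ++ [a]) = next (state h) a := by simp [state]

lemma next_of_single {s : State m} (hs : s.single = true) (a : Answer (m + 1)) : next s a =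
    ⟨false, s.seen, s.reps, s.weight, s.hits + (if a = miss then 0 else 1), s.rounds + 1⟩ := by
  rw [next, if_pos hs]

lemma next_hit_of_mem {s : State m} (hs : s.single = false) {u : Fin (m + 1)} (hu : u ∈ s.seen) :
    next s (hit u) = ⟨true, s.seen, s.reps + 1, s.weight + s.seen.card, s.hits, s.rounds⟩ := by
  rw [next, if_neg (by simp [hs]), if_neg]
  rintro ⟨v, hv, h⟩
  exact hv (hit_injective h ▸ hu)

lemma next_hit_of_notMem {s : State m} (hs : s.single = false) {u : Fin (m + 1)}
    (hu : u ∉ s.seen) : next s (hit u) =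
      ⟨true, insert u s.seen, s.reps, s.weight + s.seen.card, s.hits, s.rounds⟩ := by
  rw [next, if_neg (by simp [hs]), if_pos ⟨u, hu, rfl⟩]
  congr 1
  ext v
  simp only [Finset.mem_union, Finset.mem_filter, Finset.mem_univ, true_and, Finset.mem_insert]
  rw [or_comm, hit_injective.eq_iff, eq_comm]

lemma next_miss {s : State m} (hs : s.single = false) :
    next s miss = ⟨true, s.seen, s.reps + 1, s.weight + s.seen.card, s.hits, s.rounds⟩ := by
  rw [next, if_neg (by simp [hs]), if_neg]
  rintro ⟨v, -, h⟩
  exact hit_ne_miss v h.symm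

/-- The samples on the universe alternate with those on single elements, and each of the former
shows a new element or counts as a repetition. -/
lemma state_counts (h : List (Answer (m + 1))) :
    (state h).reps + (state h).seen.card = (state h).rounds + (if (state h).single then 1 else 0) ∧
      h.length = (state h).reps + (state h).seen.card + (state h).rounds := by
  induction h using List.reverseRecOn with
  | nil => simp [state]
  | append_singleton h a ih =>
    rw [state_append, List.length_append, List.length_singleton]
    obtain ⟨h1, h2⟩ := ih
    rcases hs : (state h).single with _ | _
    · rw [hs] at h1
      rcases eq_miss_or_eq_hit a with rfl | ⟨u, rfl⟩
      · rw [next_miss hs]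
        simp only [if_true] at h1 ⊢
        simp at h1
        omega
      · by_cases hu : u ∈ (state h).seen
        · rw [next_hit_of_mem hs hu]
          simp at h1 ⊢
          omega
        · rw [next_hit_of_notMem hs hu]
          simp [Finset.card_insert_of_notMem hu] at h1 ⊢
          omega
    · rw [hs] at h1
      rw [next_of_single hs]
      simp at h1 ⊢
      omega

/-- The interval that contains everything. -/
def whole : Interval (m + 1) := ⟨(0, Fin.last m), Fin.zero_le _⟩

/-- The interval with the single element `u`. -/
def singleton (u : Fin (m + 1)) : Interval (m + 1) := ⟨(u, u), le_rfl⟩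

lemma inter_whole (S : Finset (Fin (m + 1))) : S ∩ (whole (m := m)).elems = S := by
  ext v; simp [whole, Interval.elems, Fin.le_last]

lemma mem_inter_singleton {S : Finset (Fin (m + 1))} {u v : Fin (m + 1)} :
    v ∈ S ∩ (singleton u).elems ↔ v ∈ S ∧ v = u := by
  simp [singleton, Interval.elems]

/-- The coin tosses: a random element for each round. -/
abbrev Coins (m : ℕ) : Type := ℕ × Unit → Fin (m + 1)

instance : IsProbabilityMeasure (uniformOn Set.univ : Measure (Fin (m + 1))) :=
  isProbabilityMeasure_uniformOn Set.finite_univ Set.univ_nonempty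

/-- The law of the coin tosses. -/
abbrev coinLaw (m : ℕ) : Measure (Coins m) :=
  tableLaw fun _ : Unit => (uniformOn Set.univ : Measure (Fin (m + 1)))

/-- The next action in a state: stop after `K` repetitions or after `K` hits by single elements,
with an estimate that makes the number of successes equal to its compensator. -/
def action (K : ℕ) (ω : Coins m) (s : State m) : Interval (m + 1) ⊕ ℝ :=
  if K ≤ s.reps then Sum.inr (s.weight / K)
  else if K ≤ s.hits then Sum.inr (((m : ℝ) + 1) * K / s.rounds)
  else Sum.inl (if s.single then singleton (ω (s.rounds, ())) else whole)

lemma action_eq_inl {K : ℕ} {ω : Coins m} {s : State m} {T : Interval (m + 1)}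
    (h : action K ω s = Sum.inl T) : s.reps < K ∧ s.hits < K ∧
      T = if s.single then singleton (ω (s.rounds, ())) else whole := by
  unfold action at h
  split_ifs at h with h1 h2 h3
  · exact ⟨by omega, by omega, by rw [if_pos h3]; exact (Sum.inl.inj h).symm⟩
  · exact ⟨by omega, by omega, by rw [if_neg h3]; exact (Sum.inl.inj h).symm⟩

/-- The non-adaptive algorithm that waits for `K` successes. -/
def algorithm (m K : ℕ) : SampleAlgorithm (m + 1) where
  Coins := Coins m
  coinLaw := coinLaw m
  step ω h := action K ω (state h)
  measurable_step h := by
    generalize state h = s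
    unfold action
    split_ifs
    · exact measurable_const
    · exact measurable_const
    · exact measurable_inl.comp ((measurable_of_countable singleton).comp (measurable_pi_apply _))
    · exact measurable_const

lemma nonAdaptive_algorithm (m K : ℕ) : (algorithm m K).NonAdaptive := by
  intro ω h h' T T' hlen hT hT'
  obtain ⟨-, -, rfl⟩ := action_eq_inl (K := K) (ω := ω) hT
  obtain ⟨-, -, rfl⟩ := action_eq_inl (K := K) (ω := ω) hT'
  obtain ⟨h1, h2⟩ := state_counts h
  obtain ⟨h3, h4⟩ := state_counts h'
  have h5 : (state h).single = (state h').single := by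
    rcases hs : (state h).single with _ | _ <;> rcases hs' : (state h').single with _ | _ <;>
      simp [hs] at h1 <;> simp [hs'] at h3 <;> first | rfl | omega
  have h6 : (state h).rounds = (state h').rounds := by rw [← h5] at h3; omega
  rw [h5, h6]

/-! ### The samples on the universe -/

section Universe

variable {S : Finset (Fin (m + 1))} {K : ℕ}

/-- Invariants of an execution: only hidden elements are seen, and the algorithm stops after `K`
repetitions. -/
def Valid (S : Finset (Fin (m + 1))) (K : ℕ) (s : State m) : Prop := s.seen ⊆ S ∧ s.reps ≤ K

/-- The potential argument for quantities that depend only on the samples on the universe. -/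
lemma law_universe_le (hS : S.Nonempty) (f : State m → ℝ)
    (hf0 : ∀ s, Valid S K s → 0 ≤ f s)
    (hsingle : ∀ s a, s.single = true → f (next s a) = f s)
    (hstep : ∀ s, Valid S K s → s.reps < K → s.single = false →
      ∑ u ∈ S, f (next s (hit u)) ≤ S.card * f s)
    (bad : List (Answer (m + 1)) → Prop)
    (hbad : ∀ h, Valid S K (state h) → bad h → 1 ≤ f (state h)) (t : ℕ) :
    (algorithm m K).law S {z | bad ((algorithm m K).history z t)} ≤
      ENNReal.ofReal (f (state [])) := by
  refine (SampleAlgorithm.law_history_le bad t ∅ _ fun ω _ => ?_).trans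
    (le_of_eq (by rw [measure_empty, add_zero]))
  refine SampleAlgorithm.answerLaw_history_le (A := algorithm m K)
    (fun h => Valid S K (state h)) (fun h => f (state h)) ⟨by simp [state], by simp [state]⟩
    (fun h hv => hf0 _ hv) ?_ ?_ bad hbad t
  all_goals
    intro h T hv hT hST
    obtain ⟨h1, h2, rfl⟩ := action_eq_inl (K := K) (ω := ω) hT
    simp only [state_append]
    generalize state h = s at *
    obtain ⟨hv1, hv2⟩ := hv
  · rcases hs : s.single with _ | _
    · simp [hs, inter_whole] at hST
      exact absurd hST hS.ne_empty
    · refine ⟨?_, (hsingle s _ hs).le⟩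
      rw [next_of_single hs]
      exact ⟨hv1, hv2⟩
  · rcases hs : s.single with _ | _
    · simp only [inter_whole, Bool.false_eq_true, if_false]
      refine ⟨fun u hu => ?_, hstep s ⟨hv1, hv2⟩ h1 hs⟩
      by_cases hus : u ∈ s.seen
      · rw [next_hit_of_mem hs hus]
        exact ⟨hv1, h1⟩
      · rw [next_hit_of_notMem hs hus]
        exact ⟨Finset.insert_subset hu hv1, hv2⟩
    · refine ⟨fun u _ => ?_, ?_⟩
      · rw [next_of_single hs]
        exact ⟨hv1, hv2⟩
      · simp only [hsingle s _ hs]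
        simp

lemma filter_mem_seen {s : State m} (h : s.seen ⊆ S) : S.filter (· ∈ s.seen) = s.seen := by
  ext v; simp only [Finset.mem_filter]; exact ⟨fun h => h.2, fun hv => ⟨h hv, hv⟩⟩

/-- Repetitions occur with conditional probability `|seen| / |S|`, so that their number times `|S|`
is close to the weight when `K` of them have occurred. -/
lemma law_weight_error_le (hS : S.Nonempty) (hK : 0 < K) {δ : ℝ} (hδ : 0 < δ) (t : ℕ) :
    (algorithm m K).law S {z | K ≤ (state ((algorithm m K).history z t)).reps ∧
      δ * (S.card * K) ≤ |(S.card : ℝ) * K - (state ((algorithm m K).history z t)).weight|} ≤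
      ENNReal.ofReal (1 / (δ ^ 2 * K)) := by
  set w : ℝ := (S.card : ℝ) with hw
  have hw0 : 0 < w := by rw [hw]; exact_mod_cast hS.card_pos
  have hK0 : (0 : ℝ) < K := by exact_mod_cast hK
  have key := law_universe_le (K := K) hS
    (fun s => ((w * s.reps - s.weight) ^ 2 + w ^ 2 * (K - s.reps)) / (δ * (w * K)) ^ 2)
    (fun s hv => by
      have : (0 : ℝ) ≤ K - s.reps := sub_nonneg.2 (by exact_mod_cast hv.2)
      positivity)
    (fun s a hs => by rw [next_of_single hs])
    (fun s hv _ hs => by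
      rw [← Finset.sum_div, ← mul_div_assoc]
      gcongr
      refine le_trans (le_of_eq ?_) (sum_ite_sq_le S (· ∈ s.seen) (w * s.reps - s.weight)
        (K - s.reps))
      refine Finset.sum_congr rfl fun u _ => ?_
      rw [filter_mem_seen hv.1]
      split_ifs with hu
      · rw [next_hit_of_mem hs hu]; push_cast; ring
      · rw [next_hit_of_notMem hs hu]; push_cast; ring)
    (fun h => K ≤ (state h).reps ∧ δ * (w * K) ≤ |w * K - (state h).weight|)
    (fun h hv ⟨h1, h2⟩ => by
      have h3 : (state h).reps = K := le_antisymm hv.2 h1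
      rw [h3, le_div_iff₀ (by positivity), sub_self, mul_zero, add_zero, one_mul,
        ← sq_abs (w * _ - _)]
      gcongr) t
  refine key.trans (le_of_eq ?_)
  congr 1
  simp only [state, List.foldl_nil, Nat.cast_zero]
  field_simp
  ring

/-- The compensator of the repetitions within the first `b` samples on the universe, halved, is at
least `growth K w b` as long as there are at most `K` repetitions. -/
def growth (K : ℕ) (w : ℝ) (b : ℕ) : ℝ := ∑ s ∈ Finset.range b, ((s - K : ℕ) : ℝ) / (2 * w)

lemma growth_add (K L : ℕ) (w : ℝ) : growth K w (K + L) = L * (L - 1) / (4 * w) := by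
  have h0 : ∀ K' ≤ K, growth K w K' = 0 := fun K' h => Finset.sum_eq_zero fun s hs => by
    rw [Finset.mem_range] at hs
    rw [Nat.sub_eq_zero_of_le (by omega)]; simp
  induction L with
  | zero => simp [h0 K le_rfl]
  | succ L ih =>
    rw [← add_assoc, growth, Finset.sum_range_succ, ← growth, ih, Nat.add_sub_cancel_left]
    push_cast
    field_simp
    ring

/-- With a seen set of size `b - reps`, a repetition is so likely that more than `K + L` samples on
the universe without `K` repetitions are unlikely. -/
lemma law_universe_time_le (hS : S.Nonempty) (K L X : ℕ) (hX : X = 2 * (K + L)) :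
    (algorithm m K).law S {z | ((algorithm m K).history z X).length = X} ≤
      ENNReal.ofReal (2 ^ K * Real.exp (-((L : ℝ) * (L - 1) / (4 * S.card)))) := by
  set w : ℝ := (S.card : ℝ) with hw
  have hw0 : 0 < w := by rw [hw]; exact_mod_cast hS.card_pos
  have key := law_universe_le (K := K) hS
    (fun s => 2 ^ K / 2 ^ s.reps *
      Real.exp (growth K w (s.reps + s.seen.card) - growth K w (K + L)))
    (fun s _ => by positivity)
    (fun s a hs => by rw [next_of_single hs])
    (fun s hv hr hs => by
      set b := s.reps + s.seen.card with hb
      set E := Real.exp (growth K w (b + 1) - growth K w (K + L)) with hE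
      have h1 : ∀ u ∈ S, 2 ^ K / 2 ^ (next s (hit u)).reps *
          Real.exp (growth K w ((next s (hit u)).reps + (next s (hit u)).seen.card) -
            growth K w (K + L)) =
          if u ∈ s.seen then 2 ^ K / 2 ^ s.reps * E / 2 else 2 ^ K / 2 ^ s.reps * E := by
        intro u _
        split_ifs with hu
        · rw [next_hit_of_mem hs hu, hE, hb]
          simp only
          rw [show s.reps + 1 + s.seen.card = s.reps + s.seen.card + 1 by ring, pow_succ]
          field_simp
        · rw [next_hit_of_notMem hs hu, hE, hb]
          simp only [Finset.card_insert_of_notMem hu]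
          rw [← add_assoc]
      rw [Finset.sum_congr rfl h1, sum_ite_half, filter_mem_seen hv.1]
      have h2 : growth K w (b + 1) = growth K w b + ((b - K : ℕ) : ℝ) / (2 * w) := by
        rw [growth, Finset.sum_range_succ, ← growth]
      have h3 : ((b - K : ℕ) : ℝ) ≤ s.seen.card := by
        have : b - K ≤ s.seen.card := by omega
        exact_mod_cast this
      have h4 : E ≤ Real.exp (growth K w b - growth K w (K + L)) *
          Real.exp (s.seen.card / (2 * w)) := by
        rw [hE, h2, ← Real.exp_add]
        refine Real.exp_le_exp.2 ?_
        have : ((b - K : ℕ) : ℝ) / (2 * w) ≤ s.seen.card / (2 * w) := by gcongr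
        linarith
      have h5 : w - (s.seen.card : ℝ) / 2 ≤ w * Real.exp (-(s.seen.card / (2 * w))) := by
        have := Real.add_one_le_exp (-((s.seen.card : ℝ) / (2 * w)))
        calc w - (s.seen.card : ℝ) / 2 = w * (-((s.seen.card : ℝ) / (2 * w)) + 1) := by
              field_simp; ring
          _ ≤ _ := by gcongr
      have h6 : 0 ≤ w - (s.seen.card : ℝ) / 2 := by
        have : (s.seen.card : ℝ) ≤ w := by
          rw [hw]; exact_mod_cast Finset.card_le_card hv.1
        linarith
      calc (w - (s.seen.card : ℝ) / 2) * (2 ^ K / 2 ^ s.reps * E)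
          ≤ (w * Real.exp (-(s.seen.card / (2 * w)))) * (2 ^ K / 2 ^ s.reps *
            (Real.exp (growth K w b - growth K w (K + L)) *
              Real.exp (s.seen.card / (2 * w)))) := by gcongr
        _ = w * (2 ^ K / 2 ^ s.reps * Real.exp (growth K w b - growth K w (K + L))) *
            (Real.exp (-(s.seen.card / (2 * w))) * Real.exp (s.seen.card / (2 * w))) := by ring
        _ = _ := by rw [← Real.exp_add, neg_add_cancel, Real.exp_zero, mul_one])
    (fun h => h.length = X)
    (fun h hv hlen => by
      obtain ⟨h1, h2⟩ := state_counts h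
      have h3 : (state h).reps + (state h).seen.card = K + L := by
        split_ifs at h1 <;> omega
      rw [h3, sub_self, Real.exp_zero, mul_one, le_div_iff₀ (by positivity), one_mul]
      exact pow_le_pow_right₀ one_le_two hv.2) X
  refine key.trans (le_of_eq ?_)
  simp only [state, List.foldl_nil, pow_zero, div_one, Finset.card_empty, growth_add]
  simp [growth]

end Universe
end Repetitions

namespace Repetitions

variable {m : ℕ}

/-! ### The samples on single elements -/

section Coins

variable {S : Finset (Fin (m + 1))} {K : ℕ}

/-- Read coin tosses until `K` of them are in `S`. -/
def coinRequest (S : Finset (Fin (m + 1))) (K : ℕ) (l : List (Fin (m + 1))) : Option Unit :=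
  if K ≤ l.countP (· ∈ S) then none else some ()

lemma lintegral_uniformOn_univ (F : Fin (m + 1) → ℝ≥0∞) :
    ∫⁻ u, F u ∂(uniformOn Set.univ : Measure (Fin (m + 1))) =
      (∑ u, F u) / ((m + 1 : ℕ) : ℝ≥0∞) := by
  rw [lintegral_fintype]
  have h1 : ∀ x : Fin (m + 1), (uniformOn Set.univ : Measure (Fin (m + 1))) {x} =
      ((m + 1 : ℕ) : ℝ≥0∞)⁻¹ := by
    intro x
    rw [uniformOn_univ, Measure.count_singleton, one_div, Fintype.card_fin]
  simp_rw [h1]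
  rw [← Finset.sum_mul, div_eq_mul_inv]

/-- The potential argument for the coin tosses; the potential depends on the number of tosses and
on the number of those in `S`. -/
lemma coinLaw_le (f : ℕ → ℕ → ℝ) (hf0 : ∀ l c, c ≤ K → 0 ≤ f l c)
    (hstep : ∀ l c, c < K → ∑ u : Fin (m + 1), (if u ∈ S then f (l + 1) (c + 1) else f (l + 1) c) ≤
      ((m : ℝ) + 1) * f l c)
    (bad : List (Fin (m + 1)) → Prop)
    (hbad : ∀ l, l.countP (· ∈ S) ≤ K → bad l → 1 ≤ f l.length (l.countP (· ∈ S))) (t : ℕ) :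
    coinLaw m {ω | bad (readList (coinRequest S K) ω t)} ≤ ENNReal.ofReal (f 0 0) := by
  have hreq : ∀ (l : List (Fin (m + 1))) (i : Unit), coinRequest S K l = some i →
      l.countP (· ∈ S) < K := by
    intro l i h
    unfold coinRequest at h
    split_ifs at h with h1
    omega
  have happ : ∀ (l : List (Fin (m + 1))) u, (l ++ [u]).countP (· ∈ S) =
      l.countP (· ∈ S) + if u ∈ S then 1 else 0 := by
    intro l u
    simp [List.countP_append, List.countP_singleton]
  refine tableLaw_readList_le _ _ (fun l => l.countP (· ∈ S) ≤ K)
    (fun l => ENNReal.ofReal (f l.length (l.countP (· ∈ S)))) (by simp) ?_ ?_ bad ?_ t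
  · intro l i _ h
    refine Filter.Eventually.of_forall fun u => ?_
    have := hreq l i h
    simp only [happ]
    split_ifs <;> omega
  · intro l i hi h
    have hlt := hreq l i h
    simp only [happ, List.length_append, List.length_singleton]
    rw [lintegral_uniformOn_univ, ← ENNReal.ofReal_sum_of_nonneg fun u _ => hf0 _ _ (by
      split_ifs <;> omega)]
    refine ENNReal.div_le_of_le_mul ?_
    rw [← ENNReal.ofReal_natCast, ← ENNReal.ofReal_mul (hf0 _ _ hi), mul_comm]
    refine ENNReal.ofReal_le_ofReal (le_trans (le_of_eq ?_)
      ((hstep l.length _ hlt).trans (le_of_eq (by push_cast; rfl))))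
    refine Finset.sum_congr rfl fun u _ => ?_
    split_ifs <;> rfl
  · intro l hi hb
    exact ENNReal.one_le_ofReal.2 (hbad l hi hb)

lemma card_filter_mem (S : Finset (Fin (m + 1))) : (Finset.univ.filter (· ∈ S)).card = S.card := by
  congr 1; ext; simp

/-- Coin tosses are in `S` with probability `|S| / (m + 1)`, so that the number of tosses is close
to its mean when `K` of them have been in `S`. -/
lemma coinLaw_error_le (hK : 0 < K) {δ : ℝ} (hδ : 0 < δ) (t : ℕ) :
    coinLaw m {ω | K ≤ (readList (coinRequest S K) ω t).countP (· ∈ S) ∧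
      δ * (((m : ℝ) + 1) * K) ≤
        |((m : ℝ) + 1) * K - S.card * (readList (coinRequest S K) ω t).length|} ≤
      ENNReal.ofReal (1 / (δ ^ 2 * K)) := by
  have hK0 : (0 : ℝ) < K := by exact_mod_cast hK
  have hcard : ((Finset.univ : Finset (Fin (m + 1))).card : ℝ) = (m : ℝ) + 1 := by simp
  have key := coinLaw_le (S := S) (K := K)
    (fun l c => ((((m : ℝ) + 1) * c - S.card * l) ^ 2 + ((m : ℝ) + 1) ^ 2 * (K - c)) /
      (δ * (((m : ℝ) + 1) * K)) ^ 2)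
    (fun l c hc => by
      have : (0 : ℝ) ≤ K - c := sub_nonneg.2 (by exact_mod_cast hc)
      positivity)
    (fun l c _ => by
      have h1 := sum_ite_sq_le (Finset.univ : Finset (Fin (m + 1))) (· ∈ S)
        (((m : ℝ) + 1) * c - S.card * l) (K - c)
      rw [hcard, card_filter_mem] at h1
      rw [← mul_div_assoc]
      simp only [← ite_div]
      rw [← Finset.sum_div]
      gcongr
      refine le_trans (le_of_eq ?_) h1
      refine Finset.sum_congr rfl fun u _ => ?_
      split_ifs <;> push_cast <;> ring)
    (fun l => K ≤ l.countP (· ∈ S) ∧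
      δ * (((m : ℝ) + 1) * K) ≤ |((m : ℝ) + 1) * K - S.card * l.length|)
    (fun l hl ⟨h1, h2⟩ => by
      rw [le_antisymm hl h1, le_div_iff₀ (by positivity), sub_self, mul_zero, add_zero, one_mul,
        ← sq_abs (_ * _ - _)]
      gcongr) t
  refine key.trans (le_of_eq ?_)
  congr 1
  simp only [Nat.cast_zero]
  field_simp
  ring

/-- It is unlikely that many coin tosses contain at most `K` elements of `S`. -/
lemma coinLaw_time_le (X : ℕ) :
    coinLaw m {ω | (readList (coinRequest S K) ω X).length = X} ≤
      ENNReal.ofReal (2 ^ K * Real.exp (-((S.card : ℝ) / (2 * ((m : ℝ) + 1)) * X))) := by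
  have hcard : ((Finset.univ : Finset (Fin (m + 1))).card : ℝ) = (m : ℝ) + 1 := by simp
  set p : ℝ := (S.card : ℝ) / (2 * ((m : ℝ) + 1)) with hp
  have hle : (S.card : ℝ) ≤ (m : ℝ) + 1 := by
    have := Finset.card_le_univ S
    rw [Fintype.card_fin] at this
    exact_mod_cast this
  have key := coinLaw_le (S := S) (K := K)
    (fun l c => 2 ^ K / 2 ^ c * Real.exp (p * l - p * X))
    (fun l c hc => by positivity)
    (fun l c _ => by
      set E := Real.exp (p * ((l + 1 : ℕ) : ℝ) - p * X) with hE
      have h1 : ∀ u ∈ (Finset.univ : Finset (Fin (m + 1))),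
          (if u ∈ S then 2 ^ K / 2 ^ (c + 1) * E else 2 ^ K / 2 ^ c * E) =
          if u ∈ S then 2 ^ K / 2 ^ c * E / 2 else 2 ^ K / 2 ^ c * E := by
        intro u _
        rw [pow_succ]
        split_ifs
        · field_simp
        · rfl
      rw [Finset.sum_congr rfl h1, sum_ite_half, hcard, card_filter_mem]
      have h2 : E = Real.exp (p * l - p * X) * Real.exp p := by
        rw [hE, ← Real.exp_add]; congr 1; push_cast; ring
      have h5 : ((m : ℝ) + 1) - (S.card : ℝ) / 2 ≤ ((m : ℝ) + 1) * Real.exp (-p) := by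
        have := Real.add_one_le_exp (-p)
        calc ((m : ℝ) + 1) - (S.card : ℝ) / 2 = ((m : ℝ) + 1) * (-p + 1) := by
              rw [hp]; field_simp; ring
          _ ≤ _ := by gcongr
      rw [h2]
      calc (((m : ℝ) + 1) - (S.card : ℝ) / 2) *
            (2 ^ K / 2 ^ c * (Real.exp (p * l - p * X) * Real.exp p))
          ≤ (((m : ℝ) + 1) * Real.exp (-p)) *
            (2 ^ K / 2 ^ c * (Real.exp (p * l - p * X) * Real.exp p)) := by gcongr
        _ = ((m : ℝ) + 1) * (2 ^ K / 2 ^ c * Real.exp (p * l - p * X)) *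
            (Real.exp (-p) * Real.exp p) := by ring
        _ = _ := by rw [← Real.exp_add, neg_add_cancel, Real.exp_zero, mul_one])
    (fun l => l.length = X)
    (fun l hl hX => by
      rw [hX, sub_self, Real.exp_zero, mul_one, le_div_iff₀ (by positivity), one_mul]
      exact pow_le_pow_right₀ one_le_two hl) X
  refine key.trans (le_of_eq ?_)
  simp

/-- The coin tosses read by `coinRequest` are those that have been used in the samples on single
elements, and those in the hidden set are the hits. -/
def Linked (S : Finset (Fin (m + 1))) (K : ℕ) (ω : Coins m) (s : State m) : Prop :=
  (readList (coinRequest S K) ω s.rounds).length = s.rounds ∧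
    (readList (coinRequest S K) ω s.rounds).countP (· ∈ S) = s.hits

/-- For given coin tosses, no event happens that is incompatible with the link between the coin
tosses and the answers. -/
lemma answerLaw_eq_zero_of_linked {ω : Coins m} (bad : List (Answer (m + 1)) → Prop)
    (hbad : ∀ h, Linked S K ω (state h) → ¬ bad h) (t : ℕ) :
    SampleAlgorithm.answerLaw S {y | bad ((algorithm m K).history (ω, y) t)} = 0 := by
  have hstep : ∀ s : State m, Linked S K ω s → s.hits < K → s.single = true → ∀ a,
      ((a ≠ miss) ↔ ω (s.rounds, ()) ∈ S) → Linked S K ω (next s a) := by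
    intro s ⟨h1, h2⟩ hK hs a ha
    rw [next_of_single hs]
    have hreq : coinRequest S K (readList (coinRequest S K) ω s.rounds) = some () := by
      rw [coinRequest, if_neg (by omega)]
    refine ⟨?_, ?_⟩
    · simp only [readList_succ_of_some hreq, List.length_append, List.length_singleton, h1]
    · simp only [readList_succ_of_some hreq, List.countP_append, h2, List.countP_singleton,
        decide_eq_true_eq, ← ha]
      by_cases hm : a = miss <;> simp [hm]
  refine SampleAlgorithm.answerLaw_history_eq_zero (A := algorithm m K)
    (fun h => Linked S K ω (state h)) ⟨rfl, rfl⟩ ?_ ?_ bad hbad t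
  · intro h T hl hT hST
    obtain ⟨-, h2, rfl⟩ := action_eq_inl (K := K) (ω := ω) hT
    rw [state_append]
    rcases hs : (state h).single with _ | _
    · rw [next_miss hs]; exact hl
    · refine hstep _ hl h2 hs _ ?_
      rw [hs, if_pos rfl] at hST
      refine iff_of_false (by simp) fun hmem => ?_
      have : ω ((state h).rounds, ()) ∈ S ∩ (singleton (ω ((state h).rounds, ()))).elems :=
        mem_inter_singleton.2 ⟨hmem, rfl⟩
      rw [hST] at this
      simp at this
  · intro h T hl hT u hu
    obtain ⟨-, h2, rfl⟩ := action_eq_inl (K := K) (ω := ω) hT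
    rw [state_append]
    rcases hs : (state h).single with _ | _
    · by_cases hus : u ∈ (state h).seen
      · rw [next_hit_of_mem hs hus]; exact hl
      · rw [next_hit_of_notMem hs hus]; exact hl
    · refine hstep _ hl h2 hs _ ?_
      rw [hs, if_pos rfl, mem_inter_singleton] at hu
      exact iff_of_true (hit_ne_miss u) (hu.2 ▸ hu.1)

/-- The number of samples on single elements is close to its mean when `K` of them are hits. -/
lemma law_hits_error_le (hK : 0 < K) {δ : ℝ} (hδ : 0 < δ) (t : ℕ) :
    (algorithm m K).law S {z | K ≤ (state ((algorithm m K).history z t)).hits ∧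
      δ * (((m : ℝ) + 1) * K) ≤
        |((m : ℝ) + 1) * K - S.card * (state ((algorithm m K).history z t)).rounds|} ≤
      ENNReal.ofReal (1 / (δ ^ 2 * K)) := by
  let B : Set (Coins m) := {ω | K ≤ (readList (coinRequest S K) ω t).countP (· ∈ S) ∧
      δ * (((m : ℝ) + 1) * K) ≤
        |((m : ℝ) + 1) * K - S.card * (readList (coinRequest S K) ω t).length|}
  let bad : List (Answer (m + 1)) → Prop := fun h => (K ≤ (state h).hits ∧
    δ * (((m : ℝ) + 1) * K) ≤ |((m : ℝ) + 1) * K - S.card * (state h).rounds|) ∧ h.length ≤ t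
  have h1 := SampleAlgorithm.law_history_le (A := algorithm m K) (S := S) bad t B 0 fun ω hω => by
    refine (answerLaw_eq_zero_of_linked bad (fun h hl hb => hω ?_) t).le
    obtain ⟨⟨hb1, hb2⟩, hb3⟩ := hb
    have h2 := (state_counts h).2
    have h3 : readList (coinRequest S K) ω t = readList (coinRequest S K) ω (state h).rounds :=
      readList_eq_of_none (by rw [coinRequest, if_pos (by rw [hl.2]; exact hb1)]) (by omega)
    change K ≤ (readList (coinRequest S K) ω t).countP (· ∈ S) ∧ δ * (((m : ℝ) + 1) * K) ≤
      |((m : ℝ) + 1) * K - S.card * (readList (coinRequest S K) ω t).length|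
    rw [h3, hl.1, hl.2]
    exact ⟨hb1, hb2⟩
  rw [zero_add] at h1
  refine le_trans (measure_mono fun z hz => ?_) (h1.trans (coinLaw_error_le hK hδ t))
  exact ⟨hz, SampleAlgorithm.length_history_le z t⟩

lemma law_coin_time_le (M X : ℕ) (hX : X = 2 * M) :
    (algorithm m K).law S {z | ((algorithm m K).history z X).length = X} ≤
      ENNReal.ofReal (2 ^ K * Real.exp (-((S.card : ℝ) / (2 * ((m : ℝ) + 1)) * M))) := by
  let B : Set (Coins m) := {ω | (readList (coinRequest S K) ω M).length = M}
  let bad : List (Answer (m + 1)) → Prop := fun h => h.length = X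
  have h1 := SampleAlgorithm.law_history_le (A := algorithm m K) (S := S) bad X B 0 fun ω hω => by
    refine (answerLaw_eq_zero_of_linked bad (fun h hl hb => hω ?_) X).le
    obtain ⟨h2, h3⟩ := state_counts h
    have hb' : h.length = X := hb
    have h4 : (state h).rounds = M := by split_ifs at h2 <;> omega
    change (readList (coinRequest S K) ω M).length = M
    rw [← h4]
    exact hl.1
  rw [zero_add] at h1
  exact h1.trans (coinLaw_time_le M)

end Coins

/-! ### Accuracy and number of samples of the non-adaptive algorithm -/

/-- If nothing is hidden, then the algorithm stops with the estimate `0` after `K` repetitions. -/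
lemma law_empty_eq_zero {K : ℕ} (bad : List (Answer (m + 1)) → Prop)
    (hbad : ∀ h, (state (m := m) h).weight = 0 → (state h).hits = 0 → h.length ≤ 2 * K →
      ¬ bad h) (t : ℕ) :
    (algorithm m K).law ∅ {z | bad ((algorithm m K).history z t)} = 0 := by
  rw [← nonpos_iff_eq_zero]
  refine (SampleAlgorithm.law_history_le bad t ∅ 0 fun ω _ => le_of_eq ?_).trans
    (le_of_eq (by rw [measure_empty, add_zero]))
  refine SampleAlgorithm.answerLaw_history_eq_zero (A := algorithm m K)
    (fun h => (state h).seen = ∅ ∧ (state h).weight = 0 ∧ (state h).hits = 0 ∧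
      (state h).reps ≤ K) (by simp [state]) ?_ ?_ bad ?_ t
  · intro h T ⟨hv1, hv2, hv3, hv4⟩ hT hST
    obtain ⟨h1, h2, rfl⟩ := action_eq_inl (K := K) (ω := ω) hT
    rw [state_append]
    rcases hs : (state h).single with _ | _
    · rw [next_miss hs]; simp [hv1, hv2, hv3]; omega
    · rw [next_of_single hs]; simp [hv1, hv2, hv3, hv4]
  · intro h T _ _ u hu
    simp at hu
  · intro h ⟨hv1, hv2, hv3, hv4⟩
    obtain ⟨h1, h2⟩ := state_counts h
    refine hbad h hv2 hv3 ?_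
    rw [hv1, Finset.card_empty] at h1 h2
    omega

/-- The accuracy of the estimate from single elements, where `a / b` estimates `w`. -/
lemma mul_div_bounds {a w b ε : ℝ} (hε : 0 < ε) (hε1 : ε ≤ 1) (hw : 0 < w) (ha : 0 < a)
    (h : |a - w * b| < ε / 2 * a) : 1 / (1 + ε) * w ≤ a / b ∧ a / b ≤ (1 + ε) * w := by
  rw [abs_lt] at h
  obtain ⟨h1, h2⟩ := h
  have hb : 0 < b := by
    by_contra hb
    nlinarith
  have h3 : w * b ≤ (1 + ε) * a := by nlinarith
  have h4 : a ≤ (1 + ε) * (w * b) := by nlinarith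
  constructor
  · rw [le_div_iff₀ hb, one_div, mul_assoc, inv_mul_le_iff₀ (by linarith)]
    exact h3
  · rw [div_le_iff₀ hb, mul_assoc]
    exact h4

/-- The accuracy of the estimate from repetitions, where `a / k` estimates `w`. -/
lemma div_bounds {a w k ε : ℝ} (hε : 0 < ε) (hε1 : ε ≤ 1) (hw : 0 < w) (hk : 0 < k)
    (h : |w * k - a| < ε / 2 * (w * k)) : 1 / (1 + ε) * w ≤ a / k ∧ a / k ≤ (1 + ε) * w := by
  rw [abs_lt] at h
  obtain ⟨h1, h2⟩ := h
  have hwk : 0 < w * k := by positivity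
  constructor
  · rw [le_div_iff₀ hk, one_div, mul_assoc, inv_mul_le_iff₀ (by linarith)]
    nlinarith
  · rw [div_le_iff₀ hk]
    nlinarith

/-- The number of successes that the algorithm waits for. Each of the two estimates then has a
relative error above `ε / 2` with probability at most `1 / 8`. -/
def successes (ε : ℝ) : ℕ := ⌈32 / ε ^ 2⌉₊

lemma le_successes {ε : ℝ} : 32 / ε ^ 2 ≤ successes ε := Nat.le_ceil _

lemma successes_pos {ε : ℝ} (hε : 0 < ε) : 0 < successes ε := Nat.ceil_pos.2 (by positivity)

lemma successes_le {ε : ℝ} (hε : 0 < ε) (hε1 : ε ≤ 1) : (successes ε : ℝ) ≤ 33 / ε ^ 2 := by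
  have h1 := (Nat.ceil_lt_add_one (a := 32 / ε ^ 2) (by positivity)).le
  have h2 : 1 ≤ 1 / ε ^ 2 := by rw [le_div_iff₀ (by positivity)]; nlinarith
  have h3 : 33 / ε ^ 2 = 32 / ε ^ 2 + 1 / ε ^ 2 := by ring
  rw [h3]
  exact h1.trans (by linarith)

lemma law_error_le (S : Finset (Fin (m + 1))) {ε : ℝ} (hε : 0 < ε) (hε1 : ε ≤ 1) (t : ℕ) :
    (algorithm m (successes ε)).law S {z | ∃ v, (algorithm m (successes ε)).step z.1
        ((algorithm m (successes ε)).history z t) = Sum.inr v ∧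
        ¬ (1 / (1 + ε) * (S.card : ℝ) ≤ v ∧ v ≤ (1 + ε) * (S.card : ℝ))} ≤
      ENNReal.ofReal (1 / 4) := by
  set K := successes ε with hK
  have hK0 : 0 < K := successes_pos hε
  have hK1 : (0 : ℝ) < K := by exact_mod_cast hK0
  have hinv : ∀ (ω : Coins m) (s : State m) (v : ℝ), action K ω s = Sum.inr v →
      (K ≤ s.reps ∧ v = s.weight / K) ∨ (K ≤ s.hits ∧ v = ((m : ℝ) + 1) * K / s.rounds) := by
    intro ω s v h
    unfold action at h
    split_ifs at h with h1 h2
    · exact Or.inl ⟨h1, (Sum.inr.inj h).symm⟩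
    · exact Or.inr ⟨h2, (Sum.inr.inj h).symm⟩
  rcases Finset.eq_empty_or_nonempty S with rfl | hS
  · refine le_trans (measure_mono (t := {z | (K ≤ (state ((algorithm m K).history z t)).hits ∨
      (state ((algorithm m K).history z t)).weight ≠ 0)}) ?_) (le_trans (le_of_eq
      (law_empty_eq_zero (fun h => K ≤ (state h).hits ∨ (state h).weight ≠ 0)
        (fun h h1 h2 _ => by omega) t)) zero_le)
    rintro z ⟨v, hv, hgood⟩
    rcases hinv _ _ _ hv with ⟨-, rfl⟩ | ⟨h1, -⟩
    · right
      intro h0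
      exact hgood (by simp [h0])
    · exact Or.inl h1
  · have hw : (0 : ℝ) < S.card := by exact_mod_cast hS.card_pos
    have h1 := law_weight_error_le hS hK0 (half_pos hε) t
    have h2 := law_hits_error_le (S := S) hK0 (half_pos hε) t
    have h3 : 1 / ((ε / 2) ^ 2 * K) ≤ 1 / 8 := by
      have := le_successes (ε := ε)
      rw [div_le_iff₀ (by positivity), ← hK] at this
      refine one_div_le_one_div_of_le (by norm_num) (by nlinarith)
    refine le_trans (le_trans (measure_mono ?_) (measure_union_le _ _)) (le_trans
      (add_le_add h1 h2) ?_)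
    · rintro z ⟨v, hv, hgood⟩
      rcases hinv _ _ _ hv with ⟨hr, rfl⟩ | ⟨hh, rfl⟩
      · refine Or.inl ⟨hr, ?_⟩
        by_contra hcon
        exact hgood (div_bounds hε hε1 hw hK1 (not_le.1 hcon))
      · refine Or.inr ⟨hh, ?_⟩
        by_contra hcon
        exact hgood (mul_div_bounds hε hε1 hw (by positivity) (not_le.1 hcon))
    · rw [← ENNReal.ofReal_add (by positivity) (by positivity)]
      exact ENNReal.ofReal_le_ofReal (by linarith)

lemma two_pow_mul_exp_le {K : ℕ} {k x : ℝ} (h : K + k ≤ x) :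
    2 ^ K * Real.exp (-x) ≤ Real.exp (-k) := by
  have h1 : (2 : ℝ) ^ K ≤ Real.exp K := by
    have h2 : (2 : ℝ) ≤ Real.exp 1 := by have := Real.exp_one_gt_d9; linarith
    calc (2 : ℝ) ^ K ≤ Real.exp 1 ^ K := by gcongr
      _ = Real.exp K := by rw [← Real.exp_nat_mul, mul_one]
  calc 2 ^ K * Real.exp (-x) ≤ Real.exp K * Real.exp (-x) := by gcongr
    _ = Real.exp (K + -x) := by rw [← Real.exp_add]
    _ ≤ _ := Real.exp_le_exp.2 (by linarith)

/-- The number of samples is `O(k √|S| K)` and `O(k (n / |S|) K)`, except with probability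
`exp (-k)`. -/
lemma exists_law_length_le {S : Finset (Fin (m + 1))} (hS : S.Nonempty) {K : ℕ} (hK : 0 < K)
    {k : ℝ} (hk : 1 ≤ k) :
    ∃ X : ℕ, (X : ℝ) ≤
      12 * k * K * min (((m + 1 : ℕ) : ℝ) / (S.card : ℝ)) (Real.sqrt (S.card : ℝ)) ∧
      (algorithm m K).law S {y | ((algorithm m K).history y X).length = X} ≤
        ENNReal.ofReal (Real.exp (-k)) := by
  set w : ℝ := (S.card : ℝ) with hw
  have hw1 : 1 ≤ w := by rw [hw]; exact_mod_cast hS.card_pos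
  have hK1 : (1 : ℝ) ≤ K := by exact_mod_cast hK
  have hkK : (K : ℝ) + k ≤ 2 * (k * K) := by nlinarith
  have hkK1 : 1 ≤ k * K := by nlinarith
  rcases le_total (((m + 1 : ℕ) : ℝ) / w) (Real.sqrt w) with hmin | hmin
  · rw [min_eq_left hmin]
    have hr1 : 1 ≤ ((m + 1 : ℕ) : ℝ) / w := by
      rw [le_div_iff₀ (by linarith), one_mul, hw]
      have := Finset.card_le_univ S
      rw [Fintype.card_fin] at this
      exact_mod_cast this
    set r := ((m + 1 : ℕ) : ℝ) / w with hr
    set M := ⌈4 * (k * K) * r⌉₊ with hM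
    have hM1 : 4 * (k * K) * r ≤ M := Nat.le_ceil _
    have hM2 := (Nat.ceil_lt_add_one (a := 4 * (k * K) * r) (by positivity)).le
    rw [← hM] at hM2
    have hkr : 1 ≤ k * K * r := one_le_mul_of_one_le_of_one_le hkK1 hr1
    refine ⟨2 * M, ?_, (law_coin_time_le M _ rfl).trans
      (ENNReal.ofReal_le_ofReal (two_pow_mul_exp_le (hkK.trans ?_)))⟩
    · push_cast; linarith
    · have h1 : w / (2 * ((m : ℝ) + 1)) * (4 * (k * K) * r) = 2 * (k * K) := by
        rw [hr]; push_cast; field_simp; norm_num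
      rw [← h1]
      gcongr
  · rw [min_eq_right hmin]
    set r := Real.sqrt w with hr
    have hr1 : 1 ≤ r := by rw [hr]; exact Real.one_le_sqrt.2 hw1
    have hrw : r * r = w := Real.mul_self_sqrt (by linarith)
    set M := ⌈3 * (k * K) * r⌉₊ with hM
    have hM1 : 3 * (k * K) * r ≤ M := Nat.le_ceil _
    have hM2 := (Nat.ceil_lt_add_one (a := 3 * (k * K) * r) (by positivity)).le
    rw [← hM] at hM2
    have hkr : 1 ≤ k * K * r := one_le_mul_of_one_le_of_one_le hkK1 hr1
    have hKr : (K : ℝ) ≤ k * K * r := by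
      have : 1 ≤ k * r := one_le_mul_of_one_le_of_one_le hk hr1
      nlinarith
    refine ⟨2 * (K + (M + 1)), ?_, (law_universe_time_le hS K (M + 1) _ rfl).trans
      (ENNReal.ofReal_le_ofReal (two_pow_mul_exp_le (hkK.trans ?_)))⟩
    · push_cast; linarith
    · rw [le_div_iff₀ (by linarith)]
      push_cast
      have h2 : (3 * (k * K) * r) * (3 * (k * K) * r) ≤ M * M :=
        mul_self_le_mul_self (by positivity) hM1
      have h3 : (3 * (k * K) * r) * (3 * (k * K) * r) = 9 * ((k * K) * (k * K)) * w := by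
        rw [← hrw]; ring
      have h4 : k * K ≤ (k * K) * (k * K) := by nlinarith
      have h5 : (k * K) * w ≤ (k * K) * (k * K) * w := by gcongr
      nlinarith

theorem isSetSizeApprox_algorithm {ε : ℝ} (hε : 0 < ε) (hε1 : ε ≤ 1) :
    (algorithm m (successes ε)).IsSetSizeApprox ε := by
  intro S
  have hK := successes_pos hε
  have hX : ∃ X : ℕ, (algorithm m (successes ε)).law S
      {y | ((algorithm m (successes ε)).history y X).length = X} ≤
        ENNReal.ofReal (Real.exp (-3)) := by
    rcases Finset.eq_empty_or_nonempty S with rfl | hS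
    · refine ⟨2 * successes ε + 1, le_trans (le_of_eq (law_empty_eq_zero
        (fun h => h.length = 2 * successes ε + 1) (fun h _ _ h1 => by omega) _)) zero_le⟩
    · obtain ⟨X, -, hX⟩ := exists_law_length_le hS hK (k := 3) (by norm_num)
      exact ⟨X, hX⟩
  obtain ⟨X, hX⟩ := hX
  refine SampleAlgorithm.le_law_outputs _ X (Real.exp (-3)) (1 / 4) (by positivity) (by norm_num)
    ?_ hX (law_error_le S hε hε1 X)
  linarith [exp_neg_three_le]

end Repetitions

theorem exists_nonAdaptive_upper_bound : ∃ C : ℝ, 0 < C ∧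
      ∀ (n : ℕ) (ε : ℝ), 0 < ε → ε ≤ 1 →
        ∃ A : SampleAlgorithm n, A.NonAdaptive ∧ A.IsSetSizeApprox ε ∧
          ∀ S : Finset (Fin n), S.Nonempty → ∀ k : ℝ, 1 ≤ k →
            A.law S
              {z | ENNReal.ofReal
                    (k * (C * min ((n : ℝ) / (S.card : ℝ)) (Real.sqrt (S.card : ℝ)) / ε ^ 2))
                    < A.sampleCount z}
              ≤ ENNReal.ofReal (Real.exp (-k)) := by
  refine ⟨396, by norm_num, fun n ε h0 h1 => ?_⟩
  rcases n with _ | m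
  · refine ⟨trivialAlgorithm 0, ?_, isSetSizeApprox_trivialAlgorithm ε, fun S hS => ?_⟩
    · intro _ _ _ T
      exact T.1.1.elim0
    · obtain ⟨u, -⟩ := hS
      exact u.elim0
  · refine ⟨Repetitions.algorithm m (Repetitions.successes ε),
      Repetitions.nonAdaptive_algorithm m _, Repetitions.isSetSizeApprox_algorithm h0 h1,
      fun S hS k hk => ?_⟩
    obtain ⟨X, hX1, hX2⟩ :=
      Repetitions.exists_law_length_le hS (Repetitions.successes_pos h0) hk
    refine (SampleAlgorithm.law_lt_sampleCount_le (hX1.trans ?_)).trans hX2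
    have h2 := Repetitions.successes_le h0 h1
    set r := min (((m + 1 : ℕ) : ℝ) / (S.card : ℝ)) (Real.sqrt (S.card : ℝ)) with hr
    have hr0 : 0 ≤ r := le_min (by positivity) (Real.sqrt_nonneg _)
    calc 12 * k * (Repetitions.successes ε) * r ≤ 12 * k * (33 / ε ^ 2) * r := by gcongr
      _ = _ := by ring

/-! ### Counting functions along injections -/

section Counting

/-- The restriction of a uniform function to the image of an injection is uniform. -/
lemma card_filter_comp_mul {m w b : ℕ} {i : Fin m → Fin w} (hi : Function.Injective i)
    (R : (Fin m → Fin b) → Prop) [DecidablePred R] :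
    (Finset.univ.filter fun σ : Fin w → Fin b => R (σ ∘ i)).card * b ^ m =
      b ^ w * (Finset.univ.filter R).card := by
  classical
  let e : (Fin w → Fin b) ≃ (Fin m → Fin b) × ({x // ¬ x ∈ Set.range i} → Fin b) :=
    (Equiv.piEquivPiSubtypeProd (fun x => x ∈ Set.range i) fun _ => Fin b).trans
      (Equiv.prodCongr ((Equiv.ofInjective i hi).symm.arrowCongr (Equiv.refl _)) (Equiv.refl _))
  have he : ∀ σ, (e σ).1 = σ ∘ i := fun σ => rfl
  have h1 : (Finset.univ.filter fun σ : Fin w → Fin b => R (σ ∘ i)).card =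
      ((Finset.univ.filter R) ×ˢ
        (Finset.univ : Finset ({x // ¬ x ∈ Set.range i} → Fin b))).card := by
    refine Finset.card_equiv e fun σ => ?_
    simp [he]
  have h2 : b ^ w = b ^ m * Fintype.card ({x // ¬ x ∈ Set.range i} → Fin b) := by
    have := Fintype.card_congr e
    rw [Fintype.card_prod] at this
    simpa using this
  rw [h1, h2, Finset.card_product, Finset.card_univ]
  ring

lemma card_filter_eq_mul_le {m w : ℕ} {s t : Fin m} (hst : s ≠ t) :
    (Finset.univ.filter fun i : Fin m → Fin w => i s = i t).card * w ≤ w ^ m := by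
  classical
  -- overwriting `i s` loses nothing, since `i s = i t`
  have h : (((Finset.univ.filter fun i : Fin m → Fin w => i s = i t) ×ˢ
      (Finset.univ : Finset (Fin w)))).card ≤ (Finset.univ : Finset (Fin m → Fin w)).card := by
    refine Finset.card_le_card_of_injOn (fun p => Function.update p.1 s p.2) (by simp) ?_
    rintro ⟨i, c⟩ hi ⟨i', c'⟩ hi' h
    simp only [Finset.coe_product, Set.mem_prod, Finset.mem_coe, Finset.mem_filter,
      Finset.mem_univ, true_and, and_true] at hi hi'
    have hc : c = c' := by simpa using congrFun h s
    have ho : ∀ r, r ≠ s → i r = i' r := fun r hr => by simpa [hr] using congrFun h r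
    have : i = i' := by
      funext r
      by_cases hr : r = s
      · rw [hr, hi, hi', ho t hst.symm]
      · exact ho r hr
    rw [this, hc]
  rw [Finset.card_product] at h
  simpa using h

/-- The birthday bound. -/
lemma card_not_injective_mul_le (m w : ℕ) [DecidablePred fun i : Fin m → Fin w => ¬ i.Injective] :
    (Finset.univ.filter fun i : Fin m → Fin w => ¬ i.Injective).card * w ≤ m ^ 2 * w ^ m := by
  classical
  have h1 : (Finset.univ.filter fun i : Fin m → Fin w => ¬ i.Injective) ⊆
      (Finset.univ.filter fun p : Fin m × Fin m => p.1 ≠ p.2).biUnion fun p =>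
        Finset.univ.filter fun i : Fin m → Fin w => i p.1 = i p.2 := by
    intro i hi
    simp only [Finset.mem_filter, Finset.mem_univ, true_and] at hi
    rw [Function.not_injective_iff] at hi
    obtain ⟨s, t, h, hne⟩ := hi
    simp only [Finset.mem_biUnion, Finset.mem_filter, Finset.mem_univ, true_and]
    exact ⟨(s, t), hne, h⟩
  calc _ ≤ (∑ p ∈ Finset.univ.filter fun p : Fin m × Fin m => p.1 ≠ p.2,
        (Finset.univ.filter fun i : Fin m → Fin w => i p.1 = i p.2).card) * w :=
        Nat.mul_le_mul_right _ ((Finset.card_le_card h1).trans Finset.card_biUnion_le)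
    _ = ∑ p ∈ Finset.univ.filter fun p : Fin m × Fin m => p.1 ≠ p.2,
        (Finset.univ.filter fun i : Fin m → Fin w => i p.1 = i p.2).card * w :=
        Finset.sum_mul _ _ _
    _ ≤ ∑ p ∈ Finset.univ.filter fun p : Fin m × Fin m => p.1 ≠ p.2, w ^ m :=
        Finset.sum_le_sum fun p hp => card_filter_eq_mul_le (Finset.mem_filter.1 hp).2
    _ ≤ m ^ 2 * w ^ m := by
        rw [Finset.sum_const, smul_eq_mul]
        refine Nat.mul_le_mul_right _ ((Finset.card_le_univ _).trans ?_)
        simp [sq]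

/-- Sampling `m` times from a random transversal `{(i, σ i)}` of `w` groups of size `b` is like
sampling from all elements of the groups, up to repetitions of a group. -/
lemma sum_card_filter_le {m w b : ℕ} (hw : 0 < w) (hb : 0 < b) (Q : (Fin m → Fin w × Fin b) → Prop)
    [DecidablePred Q] :
    ∑ σ : Fin w → Fin b,
      ((Finset.univ.filter fun i : Fin m → Fin w => Q fun t => (i t, σ (i t))).card : ℝ) / w ^ m ≤
      b ^ w * (((Finset.univ.filter Q).card : ℝ) / (w * b : ℝ) ^ m + (m : ℝ) ^ 2 / w) := by
  classical
  have h1 : ∑ σ : Fin w → Fin b,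
      (Finset.univ.filter fun i : Fin m → Fin w => Q fun t => (i t, σ (i t))).card =
      ∑ i : Fin m → Fin w,
        (Finset.univ.filter fun σ : Fin w → Fin b => Q fun t => (i t, σ (i t))).card := by
    simp only [Finset.card_filter]
    exact Finset.sum_comm
  have h2 : (Finset.univ.filter Q).card = ∑ i : Fin m → Fin w,
      (Finset.univ.filter fun c : Fin m → Fin b => Q fun t => (i t, c t)).card := by
    simp only [Finset.card_filter]
    rw [← Finset.sum_product', Finset.univ_product_univ]
    refine (Fintype.sum_equiv (Equiv.arrowProdEquivProdArrow (Fin m) (fun _ => Fin w)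
      fun _ => Fin b) _ _ fun x => ?_)
    rfl
  have h3 : (∑ σ : Fin w → Fin b,
      (Finset.univ.filter fun i : Fin m → Fin w => Q fun t => (i t, σ (i t))).card) * b ^ m ≤
      b ^ w * (Finset.univ.filter Q).card +
        (Finset.univ.filter fun i : Fin m → Fin w => ¬ i.Injective).card * (b ^ w * b ^ m) := by
    rw [h1, h2, Finset.sum_mul, Finset.mul_sum, Finset.card_filter, Finset.sum_mul,
      ← Finset.sum_add_distrib]
    refine Finset.sum_le_sum fun i _ => ?_
    by_cases hi : Function.Injective i
    · rw [← card_filter_comp_mul hi fun c => Q fun t => (i t, c t)]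
      exact Nat.le_add_right _ _
    · rw [if_pos hi, one_mul]
      refine le_trans (Nat.mul_le_mul_right _ ?_) (Nat.le_add_left _ _)
      exact (Finset.card_le_univ _).trans (by simp)
  have h4 := card_not_injective_mul_le m w
  set NI := (Finset.univ.filter fun i : Fin m → Fin w => ¬ i.Injective).card
  set q := (Finset.univ.filter Q).card
  have hw' : (0 : ℝ) < w := by exact_mod_cast hw
  have hb' : (0 : ℝ) < b := by exact_mod_cast hb
  rw [← Finset.sum_div, div_le_iff₀ (by positivity)]
  have h5 : (NI : ℝ) ≤ (m : ℝ) ^ 2 / w * w ^ m := by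
    rw [div_mul_eq_mul_div, le_div_iff₀ hw']
    exact_mod_cast h4
  refine le_of_mul_le_mul_right ?_ (show (0 : ℝ) < b ^ m by positivity)
  have h6 : (b : ℝ) ^ w * (q / (w * b : ℝ) ^ m + (m : ℝ) ^ 2 / w) * w ^ m * b ^ m =
      b ^ w * q + ((m : ℝ) ^ 2 / w * w ^ m) * (b ^ w * b ^ m) := by
    rw [mul_pow]; field_simp
  rw [h6]
  have h7 : (b : ℝ) ^ w * q + NI * (b ^ w * b ^ m) ≤
      b ^ w * q + ((m : ℝ) ^ 2 / w * w ^ m) * (b ^ w * b ^ m) := by gcongr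
  refine le_trans ?_ h7
  exact_mod_cast h3

end Counting

/-! ### Transcripts of non-adaptive algorithms -/

namespace SampleAlgorithm

variable {n : ℕ} {A : SampleAlgorithm n}

/-- The interval that is sampled in round `t` if the algorithm has not stopped before. -/
def plan (A : SampleAlgorithm n) (T₀ : Interval n) (ω : A.Coins) (t : ℕ) : Interval n :=
  open Classical in
  if h : ∃ T, ∃ h : List (Answer n), h.length = t ∧ A.step ω h = Sum.inl T then h.choose else T₀

lemma plan_eq (hA : A.NonAdaptive) (T₀ : Interval n) {ω : A.Coins} {h : List (Answer n)}
    {T : Interval n} (hT : A.step ω h = Sum.inl T) : A.plan T₀ ω h.length = T := by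
  have hex : ∃ T, ∃ h' : List (Answer n), h'.length = h.length ∧ A.step ω h' = Sum.inl T :=
    ⟨T, h, rfl, hT⟩
  rw [plan, dif_pos hex]
  obtain ⟨h', hl, hs⟩ := hex.choose_spec
  exact hA ω h' h _ _ hl hs hT

/-- The history after `m` rounds in terms of the answers to the planned samples. -/
def transcript (A : SampleAlgorithm n) (ω : A.Coins) (m : ℕ) (a : Fin m → Answer n) :
    List (Answer n) :=
  readList (fun h => (A.request ω h).map fun _ => ())
    (fun p => if hp : p.1 < m then a ⟨p.1, hp⟩ else miss) m

lemma history_eq_transcript (hA : A.NonAdaptive) (T₀ : Interval n) (ω : A.Coins)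
    (y : ℕ × Interval n → Answer n) (m : ℕ) :
    A.history (ω, y) m = A.transcript ω m fun t => y (t, A.plan T₀ ω t) := by
  have h : ∀ t, t ≤ m → A.history (ω, y) t =
      readList (fun h => (A.request ω h).map fun _ => ())
        (fun p : ℕ × Unit => if hp : p.1 < m then y (p.1, A.plan T₀ ω p.1) else miss) t := by
    intro t ht
    rw [history_eq_readList]
    induction t with
    | zero => rfl
    | succ t ih =>
      have ih' := ih (by omega)
      rcases hreq : A.request ω (readList (A.request ω) y t) with _ | T
      · rw [readList_succ_of_none hreq, readList_succ_of_none, ih']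
        rw [← ih', hreq]; rfl
      · have hlen : (readList (A.request ω) y t).length = t := by
          rcases length_readList_eq_or (A.request ω) y t with h | h
          · exact h
          · rw [h] at hreq; cases hreq
        have hplan := plan_eq hA T₀ (request_eq_some.1 hreq)
        rw [hlen] at hplan
        rw [readList_succ_of_some hreq, readList_succ_of_some (i := ()), ← ih']
        · simp [show t < m by omega, hplan]
        · rw [← ih', hreq]; rfl
  rw [h m le_rfl]
  rfl

/-- The probability of an event that depends on the first `m` rounds, if the answer to the sample
planned for round `t` is the image under `e t` of a uniform element of `β`. -/
lemma answerLaw_history_eq (hA : A.NonAdaptive) (T₀ : Interval n) (ω : A.Coins)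
    (S : Finset (Fin n)) (m : ℕ) {β : Type*} [Fintype β] [Nonempty β] [MeasurableSpace β]
    [MeasurableSingletonClass β] (e : Fin m → β → Answer n)
    (he : ∀ t : Fin m, (answerPMF S (A.plan T₀ ω t)).toMeasure =
      (uniformOn Set.univ : Measure β).map (e t))
    (P : List (Answer n) → Prop) [DecidablePred P] :
    answerLaw S {y | P (A.history (ω, y) m)} = ENNReal.ofReal
      (((Finset.univ.filter fun x : Fin m → β =>
        P (A.transcript ω m fun t => e t (x t))).card : ℝ) / (Fintype.card β : ℝ) ^ m) := by
  classical
  have : IsProbabilityMeasure (uniformOn Set.univ : Measure β) :=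
    isProbabilityMeasure_uniformOn Set.finite_univ Set.univ_nonempty
  have hmeas : ∀ t, Measurable (e t) := fun t => measurable_of_countable _
  have : ∀ t, IsProbabilityMeasure ((uniformOn Set.univ : Measure β).map (e t)) :=
    fun t => Measure.isProbabilityMeasure_map (hmeas t).aemeasurable
  let Q : Set (Fin m → Answer n) := {a | P (A.transcript ω m a)}
  have hQ : MeasurableSet Q := Q.toFinite.measurableSet
  have hinj : Function.Injective fun t : Fin m => ((t : ℕ), A.plan T₀ ω t) := by
    intro s t h
    exact Fin.ext (Prod.ext_iff.1 h).1
  have h1 : answerLaw S {y | P (A.history (ω, y) m)} =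
      ((answerLaw S).map fun y (t : Fin m) => y ((t : ℕ), A.plan T₀ ω t)) Q := by
    rw [Measure.map_apply (by fun_prop) hQ]
    congr 1
    ext y
    simp only [Set.mem_ofPred_eq, Set.mem_preimage, Q, history_eq_transcript hA T₀]
  have h2 : ((answerLaw S).map fun y (t : Fin m) => y ((t : ℕ), A.plan T₀ ω t)) =
      (uniformOn Set.univ : Measure (Fin m → β)).map fun x t => e t (x t) := by
    have h3 := Measure.map_infinitePi_infinitePi_of_inj
      (P := fun p : ℕ × Interval n => (answerPMF S p.2).toMeasure) hinj
    rw [h3, Measure.infinitePi_eq_pi]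
    simp only [he]
    rw [← Measure.pi_map_pi fun t => (hmeas t).aemeasurable, ← uniformOn_pi, Set.pi_univ]
  rw [h1, h2, Measure.map_apply (measurable_of_countable _) hQ, uniformOn_univ]
  have h4 : (fun (x : Fin m → β) t => e t (x t)) ⁻¹' Q =
      ((Finset.univ.filter fun x : Fin m → β =>
        P (A.transcript ω m fun t => e t (x t)) : Finset (Fin m → β)) : Set (Fin m → β)) := by
    ext x; simp [Q]
  have hcard : (0 : ℝ) < Fintype.card β := by exact_mod_cast Fintype.card_pos
  rw [h4, Measure.count_apply_finset, ENNReal.ofReal_div_of_pos (by positivity),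
    ENNReal.ofReal_natCast, ENNReal.ofReal_pow hcard.le, ENNReal.ofReal_natCast]
  congr 1
  simp

end SampleAlgorithm

/-! ### Hidden sets in blocks -/

section Blocks

variable {n w q : ℕ}

/-- The element number `5 * i + b` of the block number `j`; a block consists of `w` groups of `5`
elements. -/
def blockElem (hq : 5 * w * q ≤ n) (j : Fin q) (x : Fin w × Fin 5) : Fin n :=
  ⟨5 * w * j + (5 * x.1 + x.2), by
    have h1 := x.1.2
    have h2 := x.2.2
    have h3 : 5 * w * (j + 1) ≤ 5 * w * q := Nat.mul_le_mul_left _ j.2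
    rw [mul_add] at h3
    omega⟩

lemma blockElem_injective (hq : 5 * w * q ≤ n) (j : Fin q) :
    Function.Injective (blockElem hq j) := by
  rintro ⟨i, b⟩ ⟨i', b'⟩ h
  have h1 : 5 * w * (j : ℕ) + (5 * (i : ℕ) + b) = 5 * w * j + (5 * i' + b') := Fin.ext_iff.1 h
  have h2 := b.2
  have h3 := b'.2
  ext <;> simp only <;> omega

lemma blockElem_div (hq : 5 * w * q ≤ n) (j : Fin q) (x : Fin w × Fin 5) :
    5 * w * (j : ℕ) ≤ blockElem hq j x ∧ (blockElem hq j x : ℕ) < 5 * w * j + 5 * w := by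
  have h1 := x.1.2
  have h2 := x.2.2
  simp only [blockElem]
  omega

/-- All elements of a block. -/
def block (hq : 5 * w * q ≤ n) (j : Fin q) : Finset (Fin n) :=
  Finset.univ.map ⟨blockElem hq j, blockElem_injective hq j⟩

lemma section_injective (hq : 5 * w * q ≤ n) (j : Fin q) (σ : Fin w → Fin 5) :
    Function.Injective fun i => blockElem hq j (i, σ i) := fun _ _ h =>
  (Prod.ext_iff.1 (blockElem_injective hq j h)).1

/-- One element of each group of a block. -/
def transversal (hq : 5 * w * q ≤ n) (j : Fin q) (σ : Fin w → Fin 5) : Finset (Fin n) :=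
  Finset.univ.map ⟨fun i => blockElem hq j (i, σ i), section_injective hq j σ⟩

lemma card_block (hq : 5 * w * q ≤ n) (j : Fin q) : (block hq j).card = 5 * w := by
  simp [block, mul_comm]

lemma card_transversal (hq : 5 * w * q ≤ n) (j : Fin q) (σ : Fin w → Fin 5) :
    (transversal hq j σ).card = w := by
  simp [transversal]

/-- An interval splits a block if it contains some, but not all of its elements. -/
def Splits (hq : 5 * w * q ≤ n) (T : Interval n) (j : Fin q) : Prop :=
  (∃ x, blockElem hq j x ∈ T.elems) ∧ ∃ x, blockElem hq j x ∉ T.elems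

open Classical in
/-- An interval splits at most the two blocks that contain its endpoints. -/
lemma card_splits_le (hq : 5 * w * q ≤ n) (T : Interval n) :
    (Finset.univ.filter (Splits hq T)).card ≤ 2 := by
  have h : (Finset.univ.filter (Splits hq T)).image (Fin.val : Fin q → ℕ) ⊆
      {(T.1.1 : ℕ) / (5 * w), (T.1.2 : ℕ) / (5 * w)} := by
    intro k hk
    simp only [Finset.mem_image, Finset.mem_filter, Finset.mem_univ, true_and] at hk
    obtain ⟨j, ⟨⟨x, hx⟩, ⟨y, hy⟩⟩, rfl⟩ := hk
    obtain ⟨hx1, hx2⟩ := blockElem_div hq j x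
    obtain ⟨hy1, hy2⟩ := blockElem_div hq j y
    simp only [Interval.elems, Finset.mem_Icc, Fin.le_def, not_and, not_le] at hx hy
    obtain ⟨hx3, hx4⟩ := hx
    simp only [Finset.mem_insert, Finset.mem_singleton]
    rcases Nat.lt_or_ge (blockElem hq j y) T.1.1 with hlt | hge
    · left
      symm
      rw [Nat.div_eq_iff (by omega)]
      constructor <;> rw [mul_comm] <;> omega
    · right
      have := hy hge
      symm
      rw [Nat.div_eq_iff (by omega)]
      constructor <;> rw [mul_comm] <;> omega
  rw [← Finset.card_image_of_injective _ Fin.val_injective]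
  exact (Finset.card_le_card h).trans Finset.card_le_two

variable {A : SampleAlgorithm n}

open Classical in
/-- For given coin tosses, a random transversal of a random block has at most the probability of
the whole block for any event in the first `m` rounds, up to an error: with `m` samples, at most
`2 * m` blocks are split, and for the others the two kinds of hidden sets can only be told apart
if two answers show elements of the same group. -/
lemma sum_answerLaw_le (hA : A.NonAdaptive) (T₀ : Interval n) (hq : 5 * w * q ≤ n) (hw : 0 < w)
    (ω : A.Coins) (m : ℕ) (P : List (Answer n) → Prop) :
    ∑ j : Fin q, ∑ σ : Fin w → Fin 5,
      SampleAlgorithm.answerLaw (transversal hq j σ) {y | P (A.history (ω, y) m)} ≤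
      5 ^ w * (∑ j : Fin q, SampleAlgorithm.answerLaw (block hq j) {y | P (A.history (ω, y) m)} +
        ENNReal.ofReal (q * ((m : ℝ) ^ 2 / w) + 2 * m)) := by
  have : Nonempty (Fin w) := ⟨⟨0, hw⟩⟩
  let T : ℕ → Interval n := A.plan T₀ ω
  let split : Finset (Fin q) := Finset.univ.filter fun j => ∃ t : Fin m, Splits hq (T t) j
  have hsplit : split.card ≤ 2 * m := by
    have h1 : split ⊆ (Finset.univ : Finset (Fin m)).biUnion fun t =>
        Finset.univ.filter (Splits hq (T t)) := by
      intro j hj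
      simpa [split] using hj
    calc split.card ≤ ∑ t : Fin m, (Finset.univ.filter (Splits hq (T t))).card :=
          (Finset.card_le_card h1).trans Finset.card_biUnion_le
      _ ≤ ∑ _t : Fin m, 2 := Finset.sum_le_sum fun t _ => card_splits_le hq _
      _ = 2 * m := by simp [mul_comm]
  have hone : ∀ j : Fin q, ∑ σ : Fin w → Fin 5,
      SampleAlgorithm.answerLaw (transversal hq j σ) {y | P (A.history (ω, y) m)} ≤
      5 ^ w * (SampleAlgorithm.answerLaw (block hq j) {y | P (A.history (ω, y) m)} +
        (ENNReal.ofReal ((m : ℝ) ^ 2 / w) + if j ∈ split then 1 else 0)) := by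
    intro j
    by_cases hj : j ∈ split
    · rw [if_pos hj]
      calc _ ≤ ∑ σ : Fin w → Fin 5, (1 : ℝ≥0∞) := Finset.sum_le_sum fun σ _ => prob_le_one
        _ = 5 ^ w * 1 := by simp
        _ ≤ _ := by
          gcongr
          exact le_add_left (le_add_left le_rfl)
    · rw [if_neg hj, add_zero]
      have hclean : ∀ t : Fin m, (∀ x, blockElem hq j x ∉ (T t).elems) ∨
          ∀ x, blockElem hq j x ∈ (T t).elems := by
        intro t
        by_contra hcon
        push Not at hcon
        exact hj (by simp only [split, Finset.mem_filter, Finset.mem_univ, true_and]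
                     exact ⟨t, hcon⟩)
      let e : Fin m → Fin w × Fin 5 → Answer n := fun t x =>
        if ∀ x, blockElem hq j x ∈ (T t).elems then hit (blockElem hq j x) else miss
      -- the law of an answer, for any hidden set listed by a part of the block
      have hlaw : ∀ {β : Type} [Fintype β] [Nonempty β] [MeasurableSpace β]
          [MeasurableSingletonClass β] (g : β → Fin w × Fin 5)
          (hg : Function.Injective fun b => blockElem hq j (g b)) (t : Fin m),
          (answerPMF (Finset.univ.map ⟨fun b => blockElem hq j (g b), hg⟩) (T t)).toMeasure =
            (uniformOn Set.univ : Measure β).map fun b => e t (g b) := by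
        intro β _ hβ _ _ g hg t
        obtain ⟨b₀⟩ := hβ
        have : IsProbabilityMeasure (uniformOn Set.univ : Measure β) :=
          isProbabilityMeasure_uniformOn Set.finite_univ ⟨b₀, trivial⟩
        rcases hclean t with h | h
        · have hne : ¬ ∀ x, blockElem hq j x ∈ (T t).elems := fun h' => h (g b₀) (h' _)
          rw [toMeasure_answerPMF_of_eq_empty]
          · simp only [e, if_neg hne, Measure.map_const, measure_univ, one_smul]
          · ext v
            simp only [Finset.mem_inter, Finset.mem_map, Finset.mem_univ, true_and,
              Function.Embedding.coeFn_mk, Finset.notMem_empty, iff_false, not_and]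
            rintro ⟨b, rfl⟩
            exact h _
        · have : Nonempty β := ⟨b₀⟩
          rw [toMeasure_answerPMF_eq_map hg]
          · simp only [e, if_pos h]
          · refine Finset.inter_eq_left.2 fun v hv => ?_
            simp only [Finset.mem_map, Finset.mem_univ, true_and,
              Function.Embedding.coeFn_mk] at hv
            obtain ⟨b, rfl⟩ := hv
            exact h _
      have hblock := SampleAlgorithm.answerLaw_history_eq hA T₀ ω (block hq j) m e
        (fun t => hlaw id (blockElem_injective hq j) t) P
      have htrans : ∀ σ : Fin w → Fin 5,
          SampleAlgorithm.answerLaw (transversal hq j σ) {y | P (A.history (ω, y) m)} = _ :=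
        fun σ => SampleAlgorithm.answerLaw_history_eq hA T₀ ω (transversal hq j σ) m
          (fun t i => e t (i, σ i))
          (fun t => hlaw (fun i => (i, σ i)) (section_injective hq j σ) t) P
      simp only [htrans, hblock]
      rw [← ENNReal.ofReal_sum_of_nonneg fun σ _ => by positivity,
        ← ENNReal.ofReal_add (by positivity) (by positivity)]
      have h5 : (5 : ℝ≥0∞) ^ w = ENNReal.ofReal (5 ^ w) := by
        rw [ENNReal.ofReal_pow (by norm_num)]; norm_num
      rw [h5, ← ENNReal.ofReal_mul (by positivity)]
      refine ENNReal.ofReal_le_ofReal ?_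
      have := sum_card_filter_le (m := m) hw (b := 5) (by norm_num) fun x =>
        P (A.transcript ω m fun t => e t (x t))
      simpa using this
  calc _ ≤ ∑ j : Fin q, 5 ^ w *
        (SampleAlgorithm.answerLaw (block hq j) {y | P (A.history (ω, y) m)} +
        (ENNReal.ofReal ((m : ℝ) ^ 2 / w) + if j ∈ split then 1 else 0)) :=
        Finset.sum_le_sum fun j _ => hone j
    _ ≤ _ := by
      rw [← Finset.mul_sum, Finset.sum_add_distrib, Finset.sum_add_distrib]
      gcongr
      rw [ENNReal.ofReal_add (by positivity) (by positivity)]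
      gcongr
      · rw [ENNReal.ofReal_mul (by positivity), ENNReal.ofReal_natCast]
        simp
      · rw [Finset.sum_ite_mem, Finset.univ_inter, Finset.sum_const, nsmul_one,
          ← ENNReal.ofReal_natCast]
        refine ENNReal.ofReal_le_ofReal ?_
        exact_mod_cast hsplit

/-- The comparison of `sum_answerLaw_le`, integrated over the coin tosses. -/
lemma sum_law_le (hA : A.NonAdaptive) (T₀ : Interval n) (hq : 5 * w * q ≤ n) (hw : 0 < w)
    (m : ℕ) (E : Interval n ⊕ ℝ → Prop) (hE : MeasurableSet {a | E a}) :
    ∑ j : Fin q, ∑ σ : Fin w → Fin 5,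
      A.law (transversal hq j σ) {z | E (A.step z.1 (A.history z m))} ≤
      5 ^ w * (∑ j : Fin q, A.law (block hq j) {z | E (A.step z.1 (A.history z m))} +
        ENNReal.ofReal (q * ((m : ℝ) ^ 2 / w) + 2 * m)) := by
  have hmeas : MeasurableSet {z : A.Outcome | E (A.step z.1 (A.history z m))} :=
    SampleAlgorithm.measurable_step_history m hE
  have hlaw : ∀ S : Finset (Fin n), A.law S {z | E (A.step z.1 (A.history z m))} =
      ∫⁻ ω, SampleAlgorithm.answerLaw S {y | E (A.step ω (A.history (ω, y) m))} ∂A.coinLaw := by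
    intro S
    rw [SampleAlgorithm.law_eq, Measure.prod_apply hmeas]
    rfl
  have hsec : ∀ S : Finset (Fin n), Measurable fun ω =>
      SampleAlgorithm.answerLaw S {y | E (A.step ω (A.history (ω, y) m))} :=
    fun S => measurable_measure_prodMk_left hmeas
  simp only [hlaw]
  calc _ = ∫⁻ ω, ∑ j : Fin q, ∑ σ : Fin w → Fin 5, SampleAlgorithm.answerLaw
        (transversal hq j σ) {y | E (A.step ω (A.history (ω, y) m))} ∂A.coinLaw := by
        rw [lintegral_finsetSum _ fun j _ => Finset.measurable_sum _ fun σ _ => hsec _]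
        refine Finset.sum_congr rfl fun j _ => ?_
        rw [lintegral_finsetSum _ fun σ _ => hsec _]
    _ ≤ ∫⁻ ω, 5 ^ w * (∑ j : Fin q, SampleAlgorithm.answerLaw (block hq j)
        {y | E (A.step ω (A.history (ω, y) m))} +
        ENNReal.ofReal (q * ((m : ℝ) ^ 2 / w) + 2 * m)) ∂A.coinLaw :=
        lintegral_mono fun ω => sum_answerLaw_le hA T₀ hq hw ω m fun h => E (A.step ω h)
    _ = _ := by
        rw [lintegral_const_mul _ ((Finset.measurable_sum _ fun j _ => hsec _).add_const _),
          lintegral_add_right _ measurable_const,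
          lintegral_finsetSum _ fun j _ => hsec _]
        simp

end Blocks

/-! ### The lower bound -/

section LowerBound

variable {n : ℕ} {A : SampleAlgorithm n} {ε : ℝ}

lemma measurableSet_stops {E : ℝ → Prop} (hE : MeasurableSet {v | E v}) :
    MeasurableSet {a : Interval n ⊕ ℝ | ∃ v, a = Sum.inr v ∧ E v} := by
  convert hE.inr_image (α := Interval n) using 1
  ext a
  constructor
  · rintro ⟨v, rfl, hv⟩; exact ⟨v, hv, rfl⟩
  · rintro ⟨v, hv, rfl⟩; exact ⟨v, rfl, hv⟩

/-- An event on which the output of a correct algorithm is wrong has probability at most `1/3`. -/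
lemma law_le_third (hA : A.IsSetSizeApprox ε) (S : Finset (Fin n)) (m : ℕ)
    (E : ℝ → Prop) (hE : MeasurableSet {v | E v})
    (hES : ∀ v, E v → 1 / (1 + ε) * (S.card : ℝ) ≤ v → ¬ v ≤ (1 + ε) * (S.card : ℝ)) :
    A.law S {z | ∃ v, A.step z.1 (A.history z m) = Sum.inr v ∧ E v} ≤ ENNReal.ofReal (1 / 3) := by
  have hmeas : MeasurableSet
      {z : A.Outcome | ∃ v, A.step z.1 (A.history z m) = Sum.inr v ∧ E v} :=
    SampleAlgorithm.measurable_step_history m (measurableSet_stops hE)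
  set B := {z : A.Outcome | ∃ v, A.step z.1 (A.history z m) = Sum.inr v ∧ E v}
  set G := {z : A.Outcome | ∃ v : ℝ, A.Outputs z v ∧
        1 / (1 + ε) * (S.card : ℝ) ≤ v ∧ v ≤ (1 + ε) * (S.card : ℝ)}
  have hdis : Disjoint G B := by
    rw [Set.disjoint_left]
    rintro z ⟨v, hv, hv1, hv2⟩ ⟨v', hv', hE'⟩
    obtain rfl := hv.unique ⟨m, hv'⟩
    exact hES v hE' hv1 hv2
  have h1 : ENNReal.ofReal (2 / 3) + A.law S B ≤
      ENNReal.ofReal (2 / 3) + ENNReal.ofReal (1 / 3) := by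
    calc ENNReal.ofReal (2 / 3) + A.law S B ≤ A.law S G + A.law S B := by gcongr; exact hA S
      _ = A.law S (G ∪ B) := (measure_union hdis hmeas).symm
      _ ≤ 1 := prob_le_one
      _ = _ := by rw [← ENNReal.ofReal_add (by norm_num) (by norm_num)]; norm_num
  exact (ENNReal.add_le_add_iff_left ENNReal.ofReal_ne_top).1 h1

/-- A correct algorithm has to take at least one sample, since otherwise it would not distinguish
a nonempty set from the empty set. -/
lemma law_one_le_sampleCount (hA : A.IsSetSizeApprox ε) (h0 : 0 < ε) {S : Finset (Fin n)}
    (hS : S.Nonempty) : ENNReal.ofReal (1 / 3) ≤ A.law S {z | 1 ≤ A.sampleCount z} := by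
  have hcard : (0 : ℝ) < S.card := by exact_mod_cast hS.card_pos
  have h1 := law_le_third hA S 0 (fun v => v ≤ 0) measurableSet_Iic fun v hv h1 _ => by
    have : 0 < 1 / (1 + ε) * (S.card : ℝ) := by positivity
    linarith
  have h2 := law_le_third hA ∅ 0 (fun v => 0 < v) measurableSet_Ioi fun v hv _ h2 => by
    simp at h2; linarith
  have hfst : ∀ (S' : Finset (Fin n)) (E : ℝ → Prop), MeasurableSet {v | E v} →
      A.law S' {z | ∃ v, A.step z.1 (A.history z 0) = Sum.inr v ∧ E v} =
        A.coinLaw {ω | ∃ v, A.step ω [] = Sum.inr v ∧ E v} := by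
    intro S' E hE
    have hm : MeasurableSet {ω : A.Coins | ∃ v, A.step ω [] = Sum.inr v ∧ E v} :=
      A.measurable_step [] (measurableSet_stops hE)
    have := (measurePreserving_fst (μ := A.coinLaw)
      (ν := SampleAlgorithm.answerLaw S')).measure_preimage hm.nullMeasurableSet
    exact this
  rw [hfst ∅ _ measurableSet_Ioi, ← hfst S _ measurableSet_Ioi] at h2
  have hcover : (Set.univ : Set A.Outcome) ⊆ {z | 1 ≤ A.sampleCount z} ∪
      ({z | ∃ v, A.step z.1 (A.history z 0) = Sum.inr v ∧ v ≤ 0} ∪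
        {z | ∃ v, A.step z.1 (A.history z 0) = Sum.inr v ∧ 0 < v}) := by
    intro z _
    rcases hstep : A.step z.1 (A.history z 0) with T | v
    · left
      have : (A.history z 1).length = 1 := by
        rcases SampleAlgorithm.length_history_eq_or z 1 with h | ⟨v, hv⟩
        · exact h
        · rw [SampleAlgorithm.history]
          simp only [hstep]
          simp [SampleAlgorithm.history]
      have := SampleAlgorithm.le_sampleCount_of_length_history this
      simpa using this
    · right
      rcases le_or_gt v 0 with hv | hv
      · exact Or.inl ⟨v, hstep, hv⟩
      · exact Or.inr ⟨v, hstep, hv⟩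
  have h3 : ENNReal.ofReal (1 / 3) + ENNReal.ofReal (2 / 3) ≤
      A.law S {z | 1 ≤ A.sampleCount z} + ENNReal.ofReal (2 / 3) := by
    calc ENNReal.ofReal (1 / 3) + ENNReal.ofReal (2 / 3) = A.law S Set.univ := by
          rw [measure_univ, ← ENNReal.ofReal_add (by norm_num) (by norm_num)]; norm_num
      _ ≤ _ := measure_mono hcover
      _ ≤ A.law S {z | 1 ≤ A.sampleCount z} +
          (ENNReal.ofReal (1 / 3) + ENNReal.ofReal (1 / 3)) :=
        (measure_union_le _ _).trans (by
          gcongr; exact (measure_union_le _ _).trans (add_le_add h1 h2))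
      _ = _ := by
        rw [← ENNReal.ofReal_add (by norm_num) (by norm_num)]
        norm_num
  exact (ENNReal.add_le_add_iff_right ENNReal.ofReal_ne_top).1 h3

/-- With few samples on a set, a correct algorithm stops early with a small output. -/
lemma le_law_small_output (hA : A.IsSetSizeApprox ε) (h1 : ε ≤ 1) {S : Finset (Fin n)} {x p : ℝ}
    {m : ℕ} (hx : x ≤ m) (hp : 0 ≤ p) (hp1 : p ≤ 2 / 3)
    (h : A.law S {z | ENNReal.ofReal x ≤ A.sampleCount z} ≤ ENNReal.ofReal p) :
    ENNReal.ofReal (2 / 3 - p) ≤ A.law S {z | ∃ v, A.step z.1 (A.history z m) = Sum.inr v ∧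
      v ≤ 2 * (S.card : ℝ)} := by
  have hcover : {z : A.Outcome | ∃ v : ℝ, A.Outputs z v ∧
        1 / (1 + ε) * (S.card : ℝ) ≤ v ∧ v ≤ (1 + ε) * (S.card : ℝ)} ⊆
      {z | ∃ v, A.step z.1 (A.history z m) = Sum.inr v ∧ v ≤ 2 * (S.card : ℝ)} ∪
        {z | ENNReal.ofReal x ≤ A.sampleCount z} := by
    rintro z ⟨v, hv, -, hv2⟩
    rcases SampleAlgorithm.length_history_eq_or z m with hl | ⟨v', hv'⟩
    · right
      refine le_trans ?_ (SampleAlgorithm.le_sampleCount_of_length_history hl)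
      rw [← ENNReal.ofReal_natCast]
      exact ENNReal.ofReal_le_ofReal hx
    · left
      obtain rfl := hv.unique ⟨m, hv'⟩
      refine ⟨v, hv', hv2.trans ?_⟩
      gcongr
      linarith
  have h2 : ENNReal.ofReal (2 / 3 - p) + ENNReal.ofReal p ≤
      A.law S {z | ∃ v, A.step z.1 (A.history z m) = Sum.inr v ∧ v ≤ 2 * (S.card : ℝ)} +
        ENNReal.ofReal p := by
    calc ENNReal.ofReal (2 / 3 - p) + ENNReal.ofReal p = ENNReal.ofReal (2 / 3) := by
          rw [← ENNReal.ofReal_add (by linarith) hp]; ring_nf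
      _ ≤ _ := hA S
      _ ≤ _ := measure_mono hcover
      _ ≤ _ := (measure_union_le _ _).trans (by gcongr)
  exact (ENNReal.add_le_add_iff_right ENNReal.ofReal_ne_top).1 h2

theorem exists_nonAdaptive_lower_bound : ∃ c p : ℝ, 0 < c ∧ 0 < p ∧
      ∀ (n w : ℕ) (ε : ℝ), 1 ≤ w → w ≤ n → 0 < ε → ε ≤ 1 →
        ∀ A : SampleAlgorithm n, A.NonAdaptive → A.IsSetSizeApprox ε →
          ∃ S : Finset (Fin n), S.card = w ∧
            ENNReal.ofReal p ≤ A.law S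
              {z | ENNReal.ofReal (c * min ((n : ℝ) / (w : ℝ)) (Real.sqrt (w : ℝ)))
                    ≤ A.sampleCount z} := by
  refine ⟨1 / 400, 1 / 10, by norm_num, by norm_num, fun n w ε hw hwn h0 h1 A hA hA' => ?_⟩
  set x : ℝ := 1 / 400 * min ((n : ℝ) / (w : ℝ)) (Real.sqrt (w : ℝ)) with hx
  have hw0 : (1 : ℝ) ≤ w := by exact_mod_cast hw
  rcases le_or_gt x 1 with hx1 | hx1
  · obtain ⟨S, -, hS⟩ := Finset.exists_subset_card_eq (s := (Finset.univ : Finset (Fin n)))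
      (n := w) (by simpa using hwn)
    refine ⟨S, hS, le_trans (ENNReal.ofReal_le_ofReal (by norm_num)) ((law_one_le_sampleCount hA' h0
      (Finset.card_pos.1 (by omega))).trans (measure_mono fun z hz => ?_))⟩
    refine le_trans ?_ (show (1 : ℝ≥0∞) ≤ A.sampleCount z from hz)
    exact ENNReal.ofReal_le_one.2 hx1
  · by_contra hcon
    push Not at hcon
    have hxn : x ≤ 1 / 400 * ((n : ℝ) / w) := by
      rw [hx]; gcongr; exact min_le_left _ _
    have hxw : x ≤ 1 / 400 * Real.sqrt w := by
      rw [hx]; gcongr; exact min_le_right _ _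
    -- the number of rounds, and the number of blocks
    set m := ⌈x⌉₊ with hm
    set q := n / (5 * w) with hq
    have hm1 : x ≤ m := Nat.le_ceil x
    have hm2 : (m : ℝ) ≤ 2 * x := by
      have := Nat.ceil_lt_add_one (a := x) (by linarith)
      linarith
    have hqn : 5 * w * q ≤ n := Nat.mul_div_le n (5 * w)
    have hq1 : (n : ℝ) / w ≤ 10 * q := by
      have h2 : n < 5 * w * q + 5 * w := by
        have := Nat.lt_mul_div_succ n (show 0 < 5 * w by omega)
        rw [mul_add, mul_one] at this
        exact this
      have h3 : (n : ℝ) ≤ 5 * w * q + 5 * w := by exact_mod_cast h2.le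
      have h4 : (n : ℝ) / w ≤ 5 * q + 5 := by
        rw [div_le_iff₀ (by linarith)]; linarith
      linarith
    have hq0 : (0 : ℝ) < q := by linarith
    have hn : 0 < n := by omega
    let T₀ : Interval n := ⟨(⟨0, hn⟩, ⟨0, hn⟩), le_rfl⟩
    have hsum := sum_law_le hA T₀ hqn (by omega) m
      (fun a => ∃ v, a = Sum.inr v ∧ v ≤ 2 * (w : ℝ)) (measurableSet_stops measurableSet_Iic)
    have hlow : ∀ (j : Fin q) (σ : Fin w → Fin 5), ENNReal.ofReal (2 / 3 - 1 / 10) ≤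
        A.law (transversal hqn j σ)
          {z | ∃ v, A.step z.1 (A.history z m) = Sum.inr v ∧ v ≤ 2 * (w : ℝ)} := by
      intro j σ
      have := le_law_small_output hA' h1 hm1 (by norm_num) (by norm_num)
        (hcon _ (card_transversal hqn j σ)).le
      rwa [card_transversal] at this
    have hhigh : ∀ j : Fin q, A.law (block hqn j)
        {z | ∃ v, A.step z.1 (A.history z m) = Sum.inr v ∧ v ≤ 2 * (w : ℝ)} ≤
          ENNReal.ofReal (1 / 3) := by
      intro j
      refine law_le_third hA' _ m _ measurableSet_Iic fun v hv h2 _ => ?_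
      rw [card_block] at h2
      have h3 : 1 / 2 * ((5 * w : ℕ) : ℝ) ≤ 1 / (1 + ε) * ((5 * w : ℕ) : ℝ) := by
        gcongr
        linarith
      push_cast at h2 h3
      linarith
    have h5 : (5 : ℝ≥0∞) ^ w = ENNReal.ofReal (5 ^ w) := by
      rw [ENNReal.ofReal_pow (by norm_num)]; norm_num
    have hmain : ENNReal.ofReal (q * (5 ^ w * (2 / 3 - 1 / 10))) ≤
        ENNReal.ofReal (5 ^ w * (q * (1 / 3) + (q * ((m : ℝ) ^ 2 / w) + 2 * m))) := by
      calc ENNReal.ofReal (q * (5 ^ w * (2 / 3 - 1 / 10)))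
          = ∑ _j : Fin q, ∑ _σ : Fin w → Fin 5, ENNReal.ofReal (2 / 3 - 1 / 10) := by
            rw [ENNReal.ofReal_mul (by positivity), ENNReal.ofReal_mul (by positivity), ← h5]
            simp
        _ ≤ _ := Finset.sum_le_sum fun j _ => Finset.sum_le_sum fun σ _ => hlow j σ
        _ ≤ _ := hsum
        _ ≤ 5 ^ w * (∑ _j : Fin q, ENNReal.ofReal (1 / 3) +
            ENNReal.ofReal (q * ((m : ℝ) ^ 2 / w) + 2 * m)) := by
            gcongr with j
            exact hhigh j
        _ = _ := by
            rw [ENNReal.ofReal_mul (by positivity),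
              ENNReal.ofReal_add (p := q * (1 / 3)) (by positivity) (by positivity),
              ENNReal.ofReal_mul (p := (q : ℝ)) (by positivity), ← h5]
            simp
    rw [ENNReal.ofReal_le_ofReal_iff (by positivity)] at hmain
    have hmain' : (q : ℝ) * (2 / 3 - 1 / 10) ≤ q * (1 / 3) + (q * ((m : ℝ) ^ 2 / w) + 2 * m) := by
      refine le_of_mul_le_mul_left ?_ (show (0 : ℝ) < 5 ^ w by positivity)
      linarith
    have h6 : (m : ℝ) ^ 2 / w ≤ 1 / 40000 := by
      rw [div_le_iff₀ (by linarith)]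
      have h7 : (m : ℝ) ≤ 1 / 200 * Real.sqrt w := by linarith
      have h8 := mul_self_le_mul_self (Nat.cast_nonneg m) h7
      have h9 := Real.mul_self_sqrt (show (0 : ℝ) ≤ w by linarith)
      nlinarith
    have h7 : (q : ℝ) * ((m : ℝ) ^ 2 / w) ≤ q * (1 / 40000) := by gcongr
    linarith

end LowerBound

end IntervalSampling

end

theorem mainTheorem1 :
    -- lower bound for non-adaptive algorithms
    (∃ c p : ℝ, 0 < c ∧ 0 < p ∧
      ∀ (n w : ℕ) (ε : ℝ), 1 ≤ w → w ≤ n → 0 < ε → ε ≤ 1 →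
        ∀ A : IntervalSampling.SampleAlgorithm n, A.NonAdaptive → A.IsSetSizeApprox ε →
          ∃ S : Finset (Fin n), S.card = w ∧
            ENNReal.ofReal p ≤ A.law S
              {z | ENNReal.ofReal (c * min ((n : ℝ) / (w : ℝ)) (Real.sqrt (w : ℝ)))
                    ≤ A.sampleCount z}) ∧
    -- upper bound for non-adaptive algorithms
    (∃ C : ℝ, 0 < C ∧
      ∀ (n : ℕ) (ε : ℝ), 0 < ε → ε ≤ 1 →
        ∃ A : IntervalSampling.SampleAlgorithm n, A.NonAdaptive ∧ A.IsSetSizeApprox ε ∧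
          ∀ S : Finset (Fin n), S.Nonempty → ∀ k : ℝ, 1 ≤ k →
            A.law S
              {z | ENNReal.ofReal
                    (k * (C * min ((n : ℝ) / (S.card : ℝ)) (Real.sqrt (S.card : ℝ)) / ε ^ 2))
                    < A.sampleCount z}
              ≤ ENNReal.ofReal (Real.exp (-k))) ∧
    -- upper bound for adaptive algorithms
    (∃ (C : ℝ) (a : ℕ), 0 < C ∧
      ∀ (n : ℕ) (ε : ℝ), 0 < ε → ε ≤ 1 →
        ∃ A : IntervalSampling.SampleAlgorithm n, A.IsSetSizeApprox ε ∧
          ∀ S : Finset (Fin n), S.Nonempty → ∀ k : ℝ, 1 ≤ k →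
            A.law S
              {z | ENNReal.ofReal
                    (k * (C * (1 + Real.log (S.card : ℝ)) ^ 4
                      * (1 + Real.log (1 + Real.log (S.card : ℝ))) ^ a / ε ^ 2))
                    < A.sampleCount z}
              ≤ ENNReal.ofReal (Real.exp (-k))) :=
  ⟨IntervalSampling.exists_nonAdaptive_lower_bound,
    IntervalSampling.exists_nonAdaptive_upper_bound, IntervalSampling.exists_adaptive_upper_bound⟩
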